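/- Let $p$ be an odd prime and $\xi_p=e^{2\pi\sqrt{-1}/p}$, and let $x\cdot y$ be the ordinary inner product on $\mathbb{F}_p^n$. For $f:\mathbb{F}_p^n\to\mathbb{F}_p$ put $\mathcal W_f(\alpha)=\sum_{x\in\mathbb{F}_p^n}\xi_p^{f(x)-\alpha\cdot x}$. The function $f$ is bent if $|\mathcal W_f(\alpha)|=p^{n/2}$ for all $\alpha\in\mathbb{F}_p^n$. In that case $\mathcal W_f(\alpha)=\pm\mu\, p^{n/2}\xi_p^{f^*(\alpha)}$ for a unique function $f^*:\mathbb{F}_p^n\to\mathbb{F}_p$, the dual of $f$, where $\mu=1$ if $p^n\equiv1\pmod 4$ and $\mu=\sqrt{-1}$ if $p^n\equiv 3\pmod 4$; and $B_+(f)$, respectively $B_-(f)$, is the set of all $\alpha$ for which the sign is $+$, respectively $-$. A bent function $f$ is weakly regular if there is $\lambda\in\{\pm1,\pm\sqrt{-1}\}$ with $\mathcal W_f(\alpha)=\lambda p^{n/2}\xi_p^{f^*(\alpha)}$ for all $\alpha$, and non-weakly regular otherwise. Let $\mathcal{DBF}$ be the set of bent functions $f$ such that $f^*$ is bent, $f(0)=0$,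 and there is a positive integer $h$ with $\gcd(h-1,p-1)=1$ and $f(ax)=a^hf(x)$ for all $a\in\mathbb{F}_p^*$, $x\in\mathbb{F}_p^n$. For $f\in\mathcal{DBF}$ and $j\in\mathbb{F}_p$ put $$c_j(f)=\{x\in B_+(f^*): f(x)=j\},\quad d_j(f)=\{x\in B_-(f^*): f(x)=j\},$$ $$c_j(f^*)=\{x\in B_+(f): f^*(x)=j\},\quad d_j(f^*)=\{x\in B_-(f): f^*(x)=j\}.$$ For $S\subseteq\mathbb{F}_p^n$ let $S^\perp=\{x: x\cdot y=0\text{ for all }y\in S\}$; a subspace $V$ is non-degenerate if $V\cap V^\perp=\{0\}$. A $d$-class symmetric association scheme on a nonempty finite set $X$ is a partition of $X\times X$ into $d+1$ nonempty symmetric relations $R_0,\dots,R_d$ such that $R_0$ is the diagonal and, for all $u,v,w$ and $(x,y)\in R_w$, the number $|\{z\in X:(x,z)\in R_u,(z,y)\in R_v\}|$ depends only on $u,v,w$. A partition $U_0=\{0\},U_1,\dots,U_d$ of $\mathbb{F}_p^n$ induces a symmetric association scheme if the relations $R_i=\{(\alpha,\beta):\alpha-\beta\in U_i\}$ form one on $\mathbb{F}_p^n$.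 The dual partition of $\{U_i\}$ is the partition of $\mathbb{F}_p^n$ into the classes of the equivalence relation: $\alpha\sim\alpha'$ if and only if $\sum_{x\in U_i}\xi_p^{\alpha\cdot x}=\sum_{x\in U_i}\xi_p^{\alpha'\cdot x}$ for all $i$. **Theorem.** Let $n\ge4$ be even, let $f:\mathbb{F}_p^n\to\mathbb{F}_p$ be a non-weakly regular bent function in $\mathcal{DBF}$, and suppose that $B_+(f)$ and $B_+(f^*)$ are both non-degenerate $r$-dimensional subspaces of $\mathbb{F}_p^n$, where $\frac n2+1\le r\le n-1$. Then $$\{0\},\ B_+(f)^\perp\setminus\{0\},\ c_0(f)\setminus B_+(f)^\perp,\ c_1(f),\dots,c_{p-1}(f),\ d_0(f),d_1(f),\dots,d_{p-1}(f)$$ is a partition of $\mathbb{F}_p^n$ into $2p+2$ nonempty sets, and it induces a $(2p+1)$-class symmetric association scheme. Its dual partition is the partition of $\mathbb{F}_p^n$ into the $2p+2$ nonempty sets $$\{0\},\ B_+(f^*)^\perp\setminus\{0\},\ c_0(f^*)\setminus B_+(f^*)^\perp,\ c_1(f^*),\dots,c_{p-1}(f^*),\ d_0(f^*),d_1(f^*),\dots,d_{p-1}(f^*).$$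 -/

import Mathlib

/-! Throughout, `ZMod p` is the prime field, `Fin n → ZMod p` is the space of `n`-tuples over it,
`x ⬝ᵥ y` is the ordinary inner product, and `ZMod.stdAddChar a` is `exp (2 * π * I * a / p)`,
that is, the power of the standard primitive `p`-th root of unity with exponent `a`. -/

/-- The Walsh transform of `f`. -/
noncomputable def walsh {p n : ℕ} [Fact p.Prime] (f : (Fin n → ZMod p) → ZMod p)
    (α : Fin n → ZMod p) : ℂ :=
  ∑ x : Fin n → ZMod p, ZMod.stdAddChar (f x - α ⬝ᵥ x)

/-- The positive real number `p ^ (n / 2)`, as a complex number. -/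
noncomputable def halfPow (p n : ℕ) : ℂ := (((p : ℝ) ^ ((n : ℝ) / 2) : ℝ) : ℂ)

/-- `f` is bent: all its Walsh coefficients have absolute value `p ^ (n / 2)`. -/
def IsBent {p n : ℕ} [Fact p.Prime] (f : (Fin n → ZMod p) → ZMod p) : Prop :=
  ∀ α, ‖walsh f α‖ = (p : ℝ) ^ ((n : ℝ) / 2)

/-- The constant `μ`: it is `1` if `p ^ n ≡ 1 (mod 4)`, and `√-1` if `p ^ n ≡ 3 (mod 4)`. -/
noncomputable def mu (p n : ℕ) : ℂ := if p ^ n % 4 = 1 then 1 else Complex.I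

/-- The dual `f^*` of `f`: the value `j` at `α` for which the Walsh coefficient at `α` is
`± μ p ^ (n / 2) ξ ^ j`. For `p` odd and `f` bent there is exactly one such `j`. -/
noncomputable def bentDual {p n : ℕ} [Fact p.Prime] (f : (Fin n → ZMod p) → ZMod p)
    (α : Fin n → ZMod p) : ZMod p :=
  Classical.epsilon fun j : ZMod p =>
    walsh f α = mu p n * halfPow p n * ZMod.stdAddChar j ∨
      walsh f α = -mu p n * halfPow p n * ZMod.stdAddChar j

/-- A bent function is weakly regular if the unit factor of its Walsh coefficients is constant. -/
def IsWeaklyRegularBent {p n : ℕ} [Fact p.Prime] (f : (Fin n → ZMod p) → ZMod p) : Prop :=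
  IsBent f ∧ ∃ c : ℂ, (c = 1 ∨ c = -1 ∨ c = Complex.I ∨ c = -Complex.I) ∧
    ∀ α, walsh f α = c * halfPow p n * ZMod.stdAddChar (bentDual f α)

/-- A bent function that is not weakly regular. -/
def IsNonWeaklyRegularBent {p n : ℕ} [Fact p.Prime] (f : (Fin n → ZMod p) → ZMod p) : Prop :=
  IsBent f ∧ ¬ IsWeaklyRegularBent f

/-- `f` and its dual are both bent. -/
def IsDualBent {p n : ℕ} [Fact p.Prime] (f : (Fin n → ZMod p) → ZMod p) : Prop :=
  IsBent f ∧ IsBent (bentDual f)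

/-- The class `DBF` of dual-bent functions. -/
def IsDBF {p n : ℕ} [Fact p.Prime] (f : (Fin n → ZMod p) → ZMod p) : Prop :=
  IsDualBent f ∧ f 0 = 0 ∧
    ∃ h : ℕ, 0 < h ∧ Nat.gcd (h - 1) (p - 1) = 1 ∧
      ∀ a : ZMod p, a ≠ 0 → ∀ x : Fin n → ZMod p, f (a • x) = a ^ h * f x

/-- The set `B_+(f)`. -/
def bPlus {p n : ℕ} [Fact p.Prime] (f : (Fin n → ZMod p) → ZMod p) : Set (Fin n → ZMod p) :=
  {α | walsh f α = mu p n * halfPow p n * ZMod.stdAddChar (bentDual f α)}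

/-- The set `B_-(f)`. -/
def bMinus {p n : ℕ} [Fact p.Prime] (f : (Fin n → ZMod p) → ZMod p) : Set (Fin n → ZMod p) :=
  {α | walsh f α = -mu p n * halfPow p n * ZMod.stdAddChar (bentDual f α)}

/-- The set `c_j(f)`. -/
def cSet {p n : ℕ} [Fact p.Prime] (f : (Fin n → ZMod p) → ZMod p) (j : ZMod p) :
    Set (Fin n → ZMod p) :=
  {x | x ∈ bPlus (bentDual f) ∧ f x = j}

/-- The set `d_j(f)`. -/
def dSet {p n : ℕ} [Fact p.Prime] (f : (Fin n → ZMod p) → ZMod p) (j : ZMod p) :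
    Set (Fin n → ZMod p) :=
  {x | x ∈ bMinus (bentDual f) ∧ f x = j}

/-- The set `c_j(f^*)`. -/
def cStarSet {p n : ℕ} [Fact p.Prime] (f : (Fin n → ZMod p) → ZMod p) (j : ZMod p) :
    Set (Fin n → ZMod p) :=
  {x | x ∈ bPlus f ∧ bentDual f x = j}

/-- The set `d_j(f^*)`. -/
def dStarSet {p n : ℕ} [Fact p.Prime] (f : (Fin n → ZMod p) → ZMod p) (j : ZMod p) :
    Set (Fin n → ZMod p) :=
  {x | x ∈ bMinus f ∧ bentDual f x = j}

/-- The orthogonal complement of a set for the ordinary inner product. -/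
def orthSet {p n : ℕ} (S : Set (Fin n → ZMod p)) : Set (Fin n → ZMod p) :=
  {x | ∀ y ∈ S, x ⬝ᵥ y = 0}

/-- `S` is an `r`-dimensional linear subspace that is non-degenerate for the ordinary inner
product. -/
def IsNondegenerateSubspace {p n : ℕ} [Fact p.Prime] (S : Set (Fin n → ZMod p)) (r : ℕ) : Prop :=
  ∃ V : Submodule (ZMod p) (Fin n → ZMod p), (V : Set (Fin n → ZMod p)) = S ∧
    Module.finrank (ZMod p) V = r ∧ {x | x ∈ V ∧ ∀ y ∈ V, x ⬝ᵥ y = 0} = {0}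

/-- An indexed family of nonempty, pairwise disjoint sets that cover `X`. -/
structure IsPartitionFamily {X ι : Type*} (U : ι → Set X) : Prop where
  nonempty : ∀ i, (U i).Nonempty
  disjoint : ∀ i j, i ≠ j → Disjoint (U i) (U j)
  cover : ⋃ i, U i = Set.univ

/-- `(X, {R_0, …, R_d})` is a `d`-class association scheme. -/
structure IsAssociationScheme {X : Type*} (d : ℕ) (R : Fin (d + 1) → Set (X × X)) : Prop where
  nonempty : Nonempty X
  finite : Finite X
  partition : IsPartitionFamily R
  diagonal : R 0 = {q | q.1 = q.2}
  transpose : ∀ j, ∃ j', {q : X × X | (q.2, q.1) ∈ R j} = R j'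
  intersection : ∀ u v w, ∃ N : ℕ, ∀ x y, (x, y) ∈ R w →
    {z | (x, z) ∈ R u ∧ (z, y) ∈ R v}.ncard = N

/-- A `d`-class association scheme all of whose relations are symmetric. -/
def IsSymmetricAssociationScheme {X : Type*} (d : ℕ) (R : Fin (d + 1) → Set (X × X)) : Prop :=
  IsAssociationScheme d R ∧ ∀ j, {q : X × X | (q.2, q.1) ∈ R j} = R j

/-- The relations `(α, β) ∈ R_i ↔ α - β ∈ U_i`. -/
def differenceRelations {G : Type*} [AddGroup G] {d : ℕ} (U : Fin (d + 1) → Set G) :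
    Fin (d + 1) → Set (G × G) :=
  fun i => {q | q.1 - q.2 ∈ U i}

open Classical in
/-- The character sum `χ_α(D)`. -/
noncomputable def charSum {p n : ℕ} [Fact p.Prime] (α : Fin n → ZMod p)
    (D : Set (Fin n → ZMod p)) : ℂ :=
  ∑ x : Fin n → ZMod p with x ∈ D, ZMod.stdAddChar (α ⬝ᵥ x)

/-- The equivalence relation that defines the dual partition of `U`, with characters identified
with vectors. -/
def dualSetoid {p n : ℕ} [Fact p.Prime] {ι : Type*} (U : ι → Set (Fin n → ZMod p)) :
    Setoid (Fin n → ZMod p) where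
  r α α' := ∀ i, charSum α (U i) = charSum α' (U i)
  iseqv := ⟨fun _ _ => rfl, fun h i => (h i).symm, fun h k i => (h i).trans (k i)⟩

/-- The dual partition of `U`, as the set of its blocks. -/
def dualPartition {p n : ℕ} [Fact p.Prime] {ι : Type*} (U : ι → Set (Fin n → ZMod p)) :
    Set (Set (Fin n → ZMod p)) :=
  (dualSetoid U).classes

/-- The family `{0}, Q \ {0}, c_0 \ Q, c_1, …, c_{p-1}, d_0, d_1, …, d_{p-1}`, in this order. -/
def schemeFamily {p n : ℕ} (Q : Set (Fin n → ZMod p)) (c d : ZMod p → Set (Fin n → ZMod p)) :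
    Fin (2 * p + 1 + 1) → Set (Fin n → ZMod p) :=
  fun i =>
    if (i : ℕ) = 0 then {0}
    else if (i : ℕ) = 1 then Q \ {0}
    else if (i : ℕ) = 2 then c 0 \ Q
    else if (i : ℕ) ≤ p + 1 then c (((i : ℕ) - 2 : ℕ) : ZMod p)
    else d (((i : ℕ) - (p + 2) : ℕ) : ZMod p)

/-- The family built from `f`. -/
def bentFamily {p n : ℕ} [Fact p.Prime] (f : (Fin n → ZMod p) → ZMod p) :
    Fin (2 * p + 1 + 1) → Set (Fin n → ZMod p) :=
  schemeFamily (orthSet (bPlus f)) (cSet f) (dSet f)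

/-- The analogous family built from `f^*`. -/
def bentStarFamily {p n : ℕ} [Fact p.Prime] (f : (Fin n → ZMod p) → ZMod p) :
    Fin (2 * p + 1 + 1) → Set (Fin n → ZMod p) :=
  schemeFamily (orthSet (bPlus (bentDual f))) (cStarSet f) (dStarSet f)

/-!
Write `n = 2 m`, `ξ` for the standard primitive `p`-th root of unity, `g = f^*`, `V = B_+(f)` and
`U = B_+(f^*)`. As `n` is even, a bent function has Walsh coefficients `± p ^ m ξ ^ j`: the prime
above `p` in `ℤ[ξ]` is unique, so the quotient of the coefficient by `p ^ m` is integral, and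
Kronecker's theorem makes it a root of unity (`exists_eq_pow_mul_stdAddChar`). The homogeneity of
`f` makes `f` and `g` even, and a parity argument in `ℤ[ξ]` gives `g^* = f`
(`bentDual_bentDual`). Comparing the Walsh transform of `f` with Fourier inversion for `g` shows
that the Fourier transform of `ξ ^ f` restricted to `U` is `p ^ m ξ ^ g` restricted to `V`, and that
of `ξ ^ f` restricted to the complement of `U` is `-p ^ m ξ ^ g` restricted to the complement of `V`
(`partialSum_bPlus_bentDual`, `partialSum_bPlus_bentDual_compl`). The same holds with `(f, U)` and
`(g, V)` exchanged; this symmetric situation is `IsSplitDualPair`.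

Two consequences carry the theorem. Since the transform of a function supported on `V` is
invariant under `V^⊥`, one has `V^⊥ ⊆ U` and `f = 0` on `V^⊥`, so that the blocks form a partition;
evaluating the transforms at `0` gives the sizes of the level sets, hence all `2p + 2` blocks are
nonempty (`IsSplitDualPair.blockIndex_surjective`). By Galois conjugation the transforms of
`ξ ^ (a f)` on `U` and on its complement are known for all `a ≠ 0`, and as `g` is homogeneous
(`exists_bentDual_smul`) their values at `α` depend only on the block of the second family that
contains `α` (`IsSplitDualPair.charSum_blockIndex_eq`).

The rest is general. The Fourier transform maps functions constant on the blocks of the first family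
injectively to functions constant on the blocks of the second, and the two spaces have the same
dimension `2p + 2`, so this is a bijection (`exists_sum_mul_charSum_fiber_eq`). Therefore the dual
partition is exactly the second family, and, as the functions constant on the blocks of the
second are closed under multiplication, those constant on the blocks of the first are closed under
convolution, which is the existence of the intersection numbers. No eigenvalues have to be compared.
-/

/-! ### Relations between powers of the root of unity -/

section CyclotomicRelations

open Polynomial

variable {p : ℕ} [Fact p.Prime]

theorem isPrimitiveRoot_stdAddChar_one : IsPrimitiveRoot (ZMod.stdAddChar (1 : ZMod p) : ℂ) p := by
  have h := Complex.isPrimitiveRoot_exp p (NeZero.ne p)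
  have h2 := ZMod.stdAddChar_coe (N := p) 1
  simp only [Int.cast_one, mul_one] at h2
  rwa [h2]

theorem stdAddChar_eq_pow_val (j : ZMod p) :
    (ZMod.stdAddChar j : ℂ) = (ZMod.stdAddChar (1 : ZMod p) : ℂ) ^ j.val := by
  rw [← AddChar.map_nsmul_eq_pow]
  simp

/-- The only integral linear relations between the `p`-th roots of unity are the multiples of
`1 + ξ + ⋯ + ξ ^ (p - 1) = 0`, because the `p`-th cyclotomic polynomial is irreducible. -/
theorem eq_of_sum_mul_stdAddChar_eq_zero (a : ZMod p → ℤ)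
    (h : ∑ j, (a j : ℂ) * ZMod.stdAddChar j = 0) (i j : ZMod p) : a i = a j := by
  have hp : p.Prime := Fact.out
  set ξ : ℂ := ZMod.stdAddChar (1 : ZMod p) with hξ
  let P : ℚ[X] := ∑ j : ZMod p, monomial j.val (a j : ℚ)
  have hcoeff : ∀ j : ZMod p, P.coeff j.val = a j := by
    intro j
    simp only [P, finsetSum_coeff, coeff_monomial]
    rw [Finset.sum_eq_single j]
    · simp
    · intro b _ hb
      rw [if_neg]
      exact fun h => hb (ZMod.val_injective p h)
    · simp
  have hdeg : P.natDegree ≤ p - 1 := by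
    apply natDegree_sum_le_of_forall_le
    intro j _
    exact (natDegree_monomial_le _).trans (Nat.le_sub_one_of_lt j.val_lt)
  have hroot : aeval ξ P = 0 := by
    rw [← h]
    simp only [P, map_sum, aeval_monomial]
    refine Finset.sum_congr rfl fun j _ => ?_
    rw [stdAddChar_eq_pow_val j, hξ]
    simp
  have hdvd : cyclotomic p ℚ ∣ P := by
    rw [cyclotomic_eq_minpoly_rat isPrimitiveRoot_stdAddChar_one hp.pos]
    exact minpoly.dvd ℚ ξ hroot
  obtain ⟨Q, hQ⟩ := hdvd
  have hQdeg : Q.natDegree = 0 := by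
    by_cases hQ0 : Q = 0
    · simp [hQ0]
    · have := natDegree_mul (cyclotomic_ne_zero p ℚ) hQ0
      rw [← hQ, natDegree_cyclotomic, Nat.totient_prime hp] at this
      omega
  obtain ⟨q, rfl⟩ : ∃ q, Q = C q := ⟨_, eq_C_of_natDegree_eq_zero hQdeg⟩
  have hall : ∀ k : ZMod p, (a k : ℚ) = q := by
    intro k
    rw [← hcoeff k, hQ, coeff_mul_C, cyclotomic_prime, finsetSum_coeff]
    simp [coeff_X_pow, k.val_lt]
  exact_mod_cast (hall i).trans (hall j).symm

theorem sum_mul_comp_eq_sum_fiber {X : Type*} (s : Finset X) (w : X → ℤ) (g : X → ZMod p)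
    (F : ZMod p → ℂ) :
    ∑ x ∈ s, (w x : ℂ) * F (g x) = ∑ j, ((∑ x ∈ s with g x = j, w x : ℤ) : ℂ) * F j := by
  rw [← Finset.sum_fiberwise s g]
  refine Finset.sum_congr rfl fun j _ => ?_
  rw [Int.cast_sum, Finset.sum_mul]
  refine Finset.sum_congr rfl fun x hx => ?_
  rw [(Finset.mem_filter.mp hx).2]

theorem sum_stdAddChar_mul (a : ZMod p) (ha : a ≠ 0) :
    ∑ j : ZMod p, (ZMod.stdAddChar (a * j) : ℂ) = 0 := by
  have := AddChar.sum_mulShift (ψ := (ZMod.stdAddChar : AddChar (ZMod p) ℂ)) a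
    (ZMod.isPrimitive_stdAddChar p)
  simp only [if_neg ha, mul_comm _ a] at this
  exact_mod_cast this

/-- A Galois conjugation `ξ ↦ ξ ^ a` preserves integral relations between roots of unity. -/
theorem sum_mul_stdAddChar_mul_eq_zero {X : Type*} (s : Finset X) (w : X → ℤ) (g : X → ZMod p)
    (h : ∑ x ∈ s, (w x : ℂ) * ZMod.stdAddChar (g x) = 0) {a : ZMod p} (ha : a ≠ 0) :
    ∑ x ∈ s, (w x : ℂ) * ZMod.stdAddChar (a * g x) = 0 := by
  rw [sum_mul_comp_eq_sum_fiber s w g] at h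
  rw [sum_mul_comp_eq_sum_fiber s w g (fun j => ZMod.stdAddChar (a * j))]
  have hc := eq_of_sum_mul_stdAddChar_eq_zero _ h
  rw [Finset.sum_congr rfl fun j _ => by rw [hc j 0], ← Finset.mul_sum, sum_stdAddChar_mul a ha,
    mul_zero]

/-- Modulo `2`, two distinct powers of `ξ` are linearly independent: for odd `u` the number
`u ξ ^ a + v ξ ^ b` can lie in `2 ℤ[ξ]` only if `a = b`. -/
theorem eq_of_sum_even_mul_stdAddChar_eq (hp : p ≠ 2) (N : ZMod p → ℤ) {u v : ℤ} (hu : Odd u)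
    (a b : ZMod p)
    (h : 2 * ∑ j, (N j : ℂ) * ZMod.stdAddChar j =
      u * ZMod.stdAddChar a + v * ZMod.stdAddChar b) : a = b := by
  by_contra hab
  have hrel : ∑ j, ((2 * N j - (if j = a then u else 0) - (if j = b then v else 0) : ℤ) : ℂ) *
      ZMod.stdAddChar j = 0 := by
    push_cast
    simp only [sub_mul, Finset.sum_sub_distrib, ite_mul, zero_mul, mul_assoc, ← Finset.mul_sum, h,
      Finset.sum_ite_eq', Finset.mem_univ, if_true]
    ring
  have hconst := eq_of_sum_mul_stdAddChar_eq_zero _ hrel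
  -- As `p ≥ 3` there is an exponent different from `a` and `b`; its coefficient is even.
  obtain ⟨k, hk⟩ : ∃ k, k ∉ ({a, b} : Finset (ZMod p)) := by
    by_contra! hall
    have h1 := Finset.card_le_card (fun k _ => hall k : (Finset.univ : Finset (ZMod p)) ⊆ {a, b})
    rw [Finset.card_univ, ZMod.card] at h1
    have h2 := (Fact.out : p.Prime).two_le
    have h3 := Finset.card_le_two (a := a) (b := b)
    omega
  simp only [Finset.mem_insert, Finset.mem_singleton, not_or] at hk
  have h1 := hconst k a
  rw [if_neg hk.1, if_neg hk.2, if_pos rfl, if_neg hab] at h1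
  obtain ⟨t, rfl⟩ := hu
  omega

end CyclotomicRelations

/-! ### Sums of roots of unity whose absolute value is a power of `p` -/

section AbsoluteValue

open NumberField

variable {p : ℕ} [Fact p.Prime]

theorem exists_embedding_apply_eq (K : Type*) [Field K] [NumberField K]
    [IsCyclotomicExtension {p} ℚ K] {ζ : K} (hζ : IsPrimitiveRoot ζ p) {z : ℂ}
    (hz : IsPrimitiveRoot z p) : ∃ φ : K →+* ℂ, φ ζ = z := by
  have hirr := Polynomial.cyclotomic.irreducible_rat (Fact.out : p.Prime).pos
  let E := hζ.embeddingsEquivPrimitiveRoots ℂ hirr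
  refine ⟨(E.symm ⟨z, (mem_primitiveRoots (Fact.out : p.Prime).pos).2 hz⟩ : K →ₐ[ℚ] ℂ), ?_⟩
  have := hζ.embeddingsEquivPrimitiveRoots_apply_coe ℂ hirr
    (E.symm ⟨z, (mem_primitiveRoots (Fact.out : p.Prime).pos).2 hz⟩)
  rw [Equiv.apply_symm_apply] at this
  exact this.symm

/-- Only one prime, generated by `ζ - 1`, divides `p`, and it is invariant under the automorphism
`ζ ↦ ζ⁻¹`. Hence if `w` times its conjugate is `p ^ (2 m)`, both factors are divisible by
`p ^ m`. -/
theorem pow_dvd_of_mul_conj_eq (K : Type*) [Field K] [NumberField K]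
    [IsCyclotomicExtension {p} ℚ K] {ζ : K} (hζ : IsPrimitiveRoot ζ p) (σ : 𝓞 K ≃+* 𝓞 K)
    (hσ : Associated (σ (hζ.toInteger - 1)) (hζ.toInteger - 1)) {w : 𝓞 K} {m : ℕ}
    (hw : w * σ w = (p : 𝓞 K) ^ (2 * m)) : (p : 𝓞 K) ^ m ∣ w := by
  have hprime : Prime (hζ.toInteger - 1) := hζ.zeta_sub_one_prime'
  have hassoc := IsCyclotomicExtension.Rat.associated_zeta_sub_one_pow_prime p hζ
  set l := hζ.toInteger - 1
  have hw2 : Associated (w * σ w) (l ^ ((p - 1) * (2 * m))) := by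
    rw [hw, pow_mul l]
    exact (hassoc.pow_pow).symm
  obtain ⟨k, hk, hwk⟩ := (dvd_prime_pow hprime _).1 ((Dvd.intro _ rfl).trans hw2.dvd : w ∣ _)
  have hwk' : Associated (σ w) (l ^ k) := by
    have := hwk.map σ
    rw [map_pow] at this
    exact this.trans hσ.pow_pow
  have h2 : Associated (l ^ (k + k)) (l ^ ((p - 1) * (2 * m))) := by
    rw [pow_add]
    exact (hwk.mul_mul hwk').symm.trans hw2
  have hk2 : k = (p - 1) * m := by
    have h3 := (pow_dvd_pow_iff hprime.ne_zero hprime.not_isUnit).1 h2.dvd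
    have h4 := (pow_dvd_pow_iff hprime.ne_zero hprime.not_isUnit).1 h2.symm.dvd
    nlinarith
  rw [hk2, pow_mul] at hwk
  exact (hwk.trans hassoc.pow_pow).symm.dvd

/-- A sum of `p`-th roots of unity of absolute value `p ^ m` is `± p ^ m` times a root of unity:
its quotient by `p ^ m` is integral, all conjugates of the quotient have absolute value `1`,
and Kronecker's theorem applies. -/
theorem exists_eq_pow_mul_stdAddChar (hp : p ≠ 2) {X : Type*} [Fintype X] (g : X → ZMod p) (m : ℕ)
    (h : ‖∑ x, (ZMod.stdAddChar (g x) : ℂ)‖ = (p : ℝ) ^ m) :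
    ∃ j : ZMod p, ∑ x, (ZMod.stdAddChar (g x) : ℂ) = (p : ℂ) ^ m * ZMod.stdAddChar j ∨
      ∑ x, (ZMod.stdAddChar (g x) : ℂ) = -((p : ℂ) ^ m) * ZMod.stdAddChar j := by
  have hpp : p.Prime := Fact.out
  obtain ⟨K, _, _, _⟩ : ∃ (K : Type) (_ : Field K) (_ : NumberField K),
      IsCyclotomicExtension {p} ℚ K :=
    ⟨CyclotomicField p ℚ, inferInstance, inferInstance,
      CyclotomicField.isCyclotomicExtension p ℚ⟩
  have hζ : IsPrimitiveRoot (IsCyclotomicExtension.zeta p ℚ K) p :=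
    IsCyclotomicExtension.zeta_spec p ℚ K
  set ζ := IsCyclotomicExtension.zeta p ℚ K
  have hζ_coe : algebraMap (𝓞 K) K hζ.toInteger = ζ := rfl
  have hirr := Polynomial.cyclotomic.irreducible_rat hpp.pos
  let τ : K ≃ₐ[ℚ] K := IsCyclotomicExtension.fromZetaAut hζ.inv hirr
  have hτ : τ ζ = ζ⁻¹ := IsCyclotomicExtension.fromZetaAut_spec hζ.inv hirr
  let σ : 𝓞 K ≃+* 𝓞 K := RingOfIntegers.mapRingEquiv τ.toRingEquiv
  have hσ_coe : ∀ z : 𝓞 K, ((σ z : 𝓞 K) : K) = τ z := fun z => rfl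
  have hσ : Associated (σ (hζ.toInteger - 1)) (hζ.toInteger - 1) := by
    have h1 := IsCyclotomicExtension.Rat.associated_sub_one_of_isPrimitiveRoot p hζ hζ.inv
    have h2 : σ (hζ.toInteger - 1) = hζ.inv.toInteger - 1 := by
      apply RingOfIntegers.ext
      rw [hσ_coe]
      simp only [map_sub, map_one, hζ_coe, hτ]
      rfl
    rw [h2]
    exact h1.symm
  let w : 𝓞 K := ∑ x, hζ.toInteger ^ (g x).val
  have hconj : ∀ φ : K →+* ℂ, φ (τ (w : K)) = (starRingEnd ℂ) (φ w) := by
    intro φ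
    have hφ : (φ ζ)⁻¹ = (starRingEnd ℂ) (φ ζ) := by
      refine Complex.inv_eq_conj ?_
      exact (hζ.map_of_injective φ.injective).norm'_eq_one hpp.ne_zero
    simp [w, hζ_coe, hτ, ← hφ]
  have hnorm : ∀ φ : K →+* ℂ, φ ((w * σ w : 𝓞 K) : K) = ((‖φ w‖ ^ 2 : ℝ) : ℂ) := by
    intro φ
    change φ ((w : K) * τ w) = _
    rw [map_mul, hconj, Complex.mul_conj, Complex.normSq_eq_norm_sq]
  obtain ⟨φ, hφ⟩ := exists_embedding_apply_eq K hζ (isPrimitiveRoot_stdAddChar_one (p := p))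
  have hφw : φ w = ∑ x, (ZMod.stdAddChar (g x) : ℂ) := by
    simp only [stdAddChar_eq_pow_val (g _)]
    simp [w, hζ_coe, hφ]
  have hww : w * σ w = (p : 𝓞 K) ^ (2 * m) := by
    apply RingOfIntegers.ext
    apply φ.injective
    rw [hnorm, hφw, h]
    simp [pow_mul, pow_right_comm]
  obtain ⟨v, hv⟩ := pow_dvd_of_mul_conj_eq K hζ σ hσ hww
  have hvnorm : ∀ ψ : K →+* ℂ, ‖ψ v‖ = 1 := by
    intro ψ
    have h1 := hnorm ψ
    rw [hww, hv] at h1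
    have h2 : ((p : ℝ) ^ m) ^ 2 * ‖ψ v‖ ^ 2 = ((p : ℝ) ^ m) ^ 2 := by
      have : (((p : ℝ) ^ m) ^ 2 : ℂ) = ((‖ψ ((p : K) ^ m * v)‖ ^ 2 : ℝ) : ℂ) := by
        simpa [pow_mul, pow_right_comm] using h1
      rw [← mul_pow]
      have h3 : ((p : ℝ) ^ m) ^ 2 = ‖ψ ((p : K) ^ m * v)‖ ^ 2 := by exact_mod_cast this
      rw [h3]
      simp
    have hpm : ((p : ℝ) ^ m) ^ 2 ≠ 0 := by
      have : (p : ℝ) ≠ 0 := by exact_mod_cast hpp.ne_zero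
      positivity
    have h4 := mul_left_cancel₀ hpm (h2.trans (mul_one _).symm)
    exact (pow_eq_one_iff_of_nonneg (norm_nonneg _) two_ne_zero).1 h4
  obtain ⟨N, hN, hvN⟩ := NumberField.Embeddings.pow_eq_one_of_norm_eq_one K ℂ
    (RingOfIntegers.isIntegral_coe v) hvnorm
  obtain ⟨r, hr⟩ := IsPrimitiveRoot.exists_neg_pow_of_isOfFinOrder (hpp.odd_of_ne_two hp) hζ
    (isOfFinOrder_iff_pow_eq_one.2 ⟨N, hN, hvN⟩)
  have hmain : ∑ x, (ZMod.stdAddChar (g x) : ℂ) =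
      (-1) ^ r * ((p : ℂ) ^ m * ZMod.stdAddChar (r : ZMod p)) := by
    have h1 : (ZMod.stdAddChar (r : ZMod p) : ℂ) = ZMod.stdAddChar (1 : ZMod p) ^ r := by
      rw [← AddChar.map_nsmul_eq_pow, nsmul_one]
    rw [← hφw, hv, h1, ← hφ]
    simp only [map_mul, map_pow, map_natCast, hr, neg_pow ζ, map_neg, map_one]
    ring
  refine ⟨r, ?_⟩
  rcases neg_one_pow_eq_or ℂ r with h1 | h1 <;> rw [hmain, h1]
  · left; ring
  · right; ring

end AbsoluteValue

/-! ### Fourier transform on `𝔽_p ^ n` -/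

section Fourier

variable {p n : ℕ} [Fact p.Prime]

theorem sum_stdAddChar_dotProduct (y : Fin n → ZMod p) :
    ∑ α : Fin n → ZMod p, (ZMod.stdAddChar (α ⬝ᵥ y) : ℂ) = if y = 0 then (p : ℂ) ^ n else 0 := by
  split_ifs with hy
  · simp [hy, ZMod.card]
  · obtain ⟨i, hi⟩ := Function.ne_iff.1 hy
    let ψ : AddChar (Fin n → ZMod p) ℂ :=
      { toFun := fun α => ZMod.stdAddChar (α ⬝ᵥ y)
        map_zero_eq_one' := by simp
        map_add_eq_mul' := fun a b => by rw [add_dotProduct, AddChar.map_add_eq_mul] }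
    refine AddChar.sum_eq_zero_of_ne_one (ψ := ψ) (AddChar.ne_one_iff.2 ?_)
    refine ⟨Pi.single i (y i)⁻¹, fun h => ?_⟩
    have h1 : (ZMod.stdAddChar (1 : ZMod p) : ℂ) = 1 := by
      have h2 : ψ (Pi.single i (y i)⁻¹) = ZMod.stdAddChar (Pi.single i (y i)⁻¹ ⬝ᵥ y) := rfl
      rw [h2, single_dotProduct, inv_mul_cancel₀ (by simpa using hi)] at h
      exact h
    rw [← AddChar.map_zero_eq_one (ZMod.stdAddChar (N := p))] at h1
    exact one_ne_zero (ZMod.injective_stdAddChar h1)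

/-- Fourier inversion. -/
theorem sum_fourier_mul_stdAddChar_neg (F : (Fin n → ZMod p) → ℂ) (y : Fin n → ZMod p) :
    ∑ α : Fin n → ZMod p, (∑ x, F x * ZMod.stdAddChar (α ⬝ᵥ x)) * ZMod.stdAddChar (-(α ⬝ᵥ y)) =
      (p : ℂ) ^ n * F y := by
  have h1 : ∀ α x : Fin n → ZMod p,
      F x * (ZMod.stdAddChar (α ⬝ᵥ x) : ℂ) * ZMod.stdAddChar (-(α ⬝ᵥ y)) =
        F x * ZMod.stdAddChar (α ⬝ᵥ (x - y)) := by
    intro α x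
    rw [mul_assoc, ← AddChar.map_add_eq_mul, dotProduct_sub, sub_eq_add_neg]
  simp_rw [Finset.sum_mul, h1]
  rw [Finset.sum_comm]
  simp_rw [← Finset.mul_sum, sum_stdAddChar_dotProduct, sub_eq_zero]
  simp [mul_comm]

theorem eq_of_fourier_eq {F H : (Fin n → ZMod p) → ℂ}
    (h : ∀ α : Fin n → ZMod p, ∑ x, F x * (ZMod.stdAddChar (α ⬝ᵥ x) : ℂ) =
      ∑ x, H x * (ZMod.stdAddChar (α ⬝ᵥ x) : ℂ)) : F = H := by
  have hp : (p : ℂ) ≠ 0 := by exact_mod_cast (Fact.out : p.Prime).ne_zero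
  funext y
  refine mul_left_cancel₀ (pow_ne_zero n hp) ?_
  rw [← sum_fourier_mul_stdAddChar_neg F, ← sum_fourier_mul_stdAddChar_neg H]
  simp_rw [h]

theorem fourier_convolution (F H : (Fin n → ZMod p) → ℂ) (α : Fin n → ZMod p) :
    ∑ x, (∑ t, F t * H (x - t)) * (ZMod.stdAddChar (α ⬝ᵥ x) : ℂ) =
      (∑ x, F x * (ZMod.stdAddChar (α ⬝ᵥ x) : ℂ)) * ∑ x, H x * (ZMod.stdAddChar (α ⬝ᵥ x) : ℂ) := by
  simp_rw [Finset.sum_mul]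
  rw [Finset.sum_comm]
  refine Finset.sum_congr rfl fun t _ => ?_
  rw [Finset.mul_sum, ← Equiv.sum_comp (Equiv.addRight t)]
  refine Finset.sum_congr rfl fun x _ => ?_
  rw [Equiv.coe_addRight, add_sub_cancel_right, dotProduct_add, AddChar.map_add_eq_mul]
  ring

theorem charSum_fiber {ι : Type*} [DecidableEq ι] (idx : (Fin n → ZMod p) → ι) (i : ι)
    (α : Fin n → ZMod p) :
    charSum α {x | idx x = i} =
      ∑ x, (if idx x = i then 1 else 0) * (ZMod.stdAddChar (α ⬝ᵥ x) : ℂ) := by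
  simp only [charSum, Set.mem_ofPred_eq, ite_mul, one_mul, zero_mul, Finset.sum_filter]

end Fourier

/-! ### Fourier-reflexive partitions and association schemes -/

section Partition

variable {p n : ℕ} [Fact p.Prime] {ι : Type*} [Fintype ι] [DecidableEq ι]
  (idx idx' : (Fin n → ZMod p) → ι)

theorem sum_mul_charSum_fiber (c : ι → ℂ) (α : Fin n → ZMod p) :
    ∑ i, c i * charSum α {x | idx x = i} =
      ∑ x, c (idx x) * (ZMod.stdAddChar (α ⬝ᵥ x) : ℂ) := by
  simp_rw [charSum_fiber, Finset.mul_sum]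
  rw [Finset.sum_comm]
  simp

/-- Let two partitions of `𝔽_p ^ n`, given as the fibres of `idx` and `idx'`, have the same number
of blocks, and let the character sums over the blocks of the first be constant on the blocks of the
second. Then the Fourier transform maps the functions constant on the blocks of the first
*onto* those constant on the blocks of the second, since it is injective and the dimensions
agree. -/
theorem exists_sum_mul_charSum_fiber_eq (hidx : Function.Surjective idx)
    (hidx' : Function.Surjective idx')
    (h : ∀ α α', idx' α = idx' α' → ∀ i, charSum α {x | idx x = i} = charSum α' {x | idx x = i})
    (b : ι → ℂ) :
    ∃ c : ι → ℂ, ∀ α, ∑ x, c (idx x) * (ZMod.stdAddChar (α ⬝ᵥ x) : ℂ) = b (idx' α) := by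
  choose s hs using hidx'
  let T : (ι → ℂ) →ₗ[ℂ] (ι → ℂ) :=
    { toFun := fun c j => ∑ i, c i * charSum (s j) {x | idx x = i}
      map_add' := fun c d => by
        funext j
        simp [add_mul, Finset.sum_add_distrib]
      map_smul' := fun t c => by
        funext j
        simp [Finset.mul_sum, mul_assoc] }
  have hT : ∀ c α, T c (idx' α) = ∑ x, c (idx x) * (ZMod.stdAddChar (α ⬝ᵥ x) : ℂ) := by
    intro c α
    rw [← sum_mul_charSum_fiber]
    exact Finset.sum_congr rfl fun i _ => by rw [h _ _ (hs (idx' α)) i]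
  have hinj : Function.Injective T := by
    intro c d hcd
    have h1 : (fun x => c (idx x)) = fun x => d (idx x) :=
      eq_of_fourier_eq fun α => by rw [← hT, ← hT, hcd]
    funext i
    obtain ⟨x, rfl⟩ := hidx i
    exact congrFun h1 x
  obtain ⟨c, hc⟩ := LinearMap.injective_iff_surjective.1 hinj b
  exact ⟨c, fun α => by rw [← hT, hc]⟩

theorem charSum_fiber_eq_iff (hidx : Function.Surjective idx) (hidx' : Function.Surjective idx')
    (h : ∀ α α', idx' α = idx' α' → ∀ i, charSum α {x | idx x = i} = charSum α' {x | idx x = i})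
    (α α' : Fin n → ZMod p) :
    (∀ i, charSum α {x | idx x = i} = charSum α' {x | idx x = i}) ↔ idx' α = idx' α' := by
  refine ⟨fun hα => ?_, h α α'⟩
  obtain ⟨c, hc⟩ := exists_sum_mul_charSum_fiber_eq idx idx' hidx hidx' h
    (fun j => if j = idx' α then 1 else 0)
  have h1 := hc α
  have h2 := hc α'
  simp only [← sum_mul_charSum_fiber, ← hα] at h1 h2
  rw [h1] at h2
  by_contra hne
  simp [Ne.symm hne] at h2

/-- Functions constant on the blocks of the second partition are closed under products; pulled back
by the Fourier transform, functions constant on the blocks of the first are closed under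
convolution. -/
theorem exists_ncard_fiber_inter_eq (hidx : Function.Surjective idx)
    (hidx' : Function.Surjective idx')
    (h : ∀ α α', idx' α = idx' α' → ∀ i, charSum α {x | idx x = i} = charSum α' {x | idx x = i})
    (u v w : ι) :
    ∃ N : ℕ, ∀ x, idx x = w → {t | idx t = u ∧ idx (x - t) = v}.ncard = N := by
  classical
  choose s hs using hidx'
  obtain ⟨c, hc⟩ := exists_sum_mul_charSum_fiber_eq idx idx' hidx (fun j => ⟨s j, hs j⟩) h
    (fun j => charSum (s j) {x | idx x = u} * charSum (s j) {x | idx x = v})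
  have hconv : (fun x => c (idx x)) = fun x => ∑ t, (if idx t = u then (1 : ℂ) else 0) *
      (if idx (x - t) = v then 1 else 0) := by
    refine eq_of_fourier_eq fun α => ?_
    rw [fourier_convolution (fun t => if idx t = u then (1 : ℂ) else 0)
      (fun t => if idx t = v then (1 : ℂ) else 0), hc, ← charSum_fiber, ← charSum_fiber,
      h _ _ (hs (idx' α)) u, h _ _ (hs (idx' α)) v]
  have hcard : ∀ x, ({t | idx t = u ∧ idx (x - t) = v}.ncard : ℂ) = c (idx x) := by
    intro x
    rw [congrFun hconv x, Set.ncard_eq_toFinset_card']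
    simp [← ite_and, Finset.sum_boole, and_comm]
  obtain ⟨x₀, hx₀⟩ := hidx w
  refine ⟨{t | idx t = u ∧ idx (x₀ - t) = v}.ncard, fun x hx => ?_⟩
  have h1 := (hcard x).trans (by rw [hx, ← hx₀] : c (idx x) = c (idx x₀))
  exact_mod_cast h1.trans (hcard x₀).symm

/-- Two partitions of `𝔽_p ^ n` with the same number of blocks, such that the character sums over
the blocks of the first are constant on the blocks of the second, make the first one induce a
symmetric association scheme, if `{0}` is a block and the blocks are symmetric. -/
theorem isSymmetricAssociationScheme_fibers {d : ℕ} (idx idx' : (Fin n → ZMod p) → Fin (d + 1))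
    (hidx : Function.Surjective idx) (hidx' : Function.Surjective idx')
    (h : ∀ α α', idx' α = idx' α' → ∀ i, charSum α {x | idx x = i} = charSum α' {x | idx x = i})
    (hzero : ∀ x, idx x = 0 ↔ x = 0) (hneg : ∀ x, idx (-x) = idx x) :
    IsSymmetricAssociationScheme d (differenceRelations fun i => {x | idx x = i}) := by
  have hsymm : ∀ j, {q : (Fin n → ZMod p) × (Fin n → ZMod p) |
      (q.2, q.1) ∈ differenceRelations (fun i => {x | idx x = i}) j} =
        differenceRelations (fun i => {x | idx x = i}) j := by
    intro j
    ext q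
    change idx (q.2 - q.1) = j ↔ idx (q.1 - q.2) = j
    rw [← neg_sub, hneg]
  refine ⟨⟨inferInstance, inferInstance, ⟨?_, ?_, ?_⟩, ?_, fun j => ⟨j, hsymm j⟩, ?_⟩, hsymm⟩
  · intro i
    obtain ⟨x, hx⟩ := hidx i
    exact ⟨(x, 0), by change idx (x - 0) = i; rwa [sub_zero]⟩
  · intro i j hij
    refine Set.disjoint_left.2 fun q hi hj => hij ?_
    exact (show idx (q.1 - q.2) = i from hi).symm.trans hj
  · exact Set.eq_univ_of_forall fun q => Set.mem_iUnion.2 ⟨idx (q.1 - q.2), rfl⟩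
  · ext q
    change idx (q.1 - q.2) = 0 ↔ q.1 = q.2
    rw [hzero, sub_eq_zero]
  · intro u v w
    obtain ⟨N, hN⟩ := exists_ncard_fiber_inter_eq idx idx' hidx hidx' h u v w
    refine ⟨N, fun x y hxy => ?_⟩
    rw [← hN (x - y) hxy]
    -- The substitution `t = x - z` turns paths from `x` to `y` into decompositions of `x - y`.
    refine Set.ncard_congr (fun z _ => x - z) ?_ ?_ ?_
    · rintro z ⟨h1, h2⟩
      refine ⟨h1, ?_⟩
      rw [sub_sub_sub_cancel_left]
      exact h2
    · intro a b _ _ hab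
      exact sub_right_injective hab
    · rintro t ⟨h1, h2⟩
      refine ⟨x - t, ⟨?_, ?_⟩, sub_sub_cancel x t⟩
      · change idx (x - (x - t)) = u
        rwa [sub_sub_cancel]
      · change idx (x - t - y) = v
        rwa [sub_right_comm]

theorem isPartitionFamily_fibers {X κ : Type*} {idx : X → κ} (hidx : Function.Surjective idx) :
    IsPartitionFamily fun i => {x | idx x = i} where
  nonempty := hidx
  disjoint _ _ hij := Set.disjoint_left.2 fun _ hi hj =>
    hij ((Eq.symm hi).trans hj)
  cover := Set.eq_univ_of_forall fun x => Set.mem_iUnion.2 ⟨idx x, rfl⟩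

theorem dualPartition_fibers (hidx : Function.Surjective idx) (hidx' : Function.Surjective idx')
    (h : ∀ α α', idx' α = idx' α' → ∀ i, charSum α {x | idx x = i} = charSum α' {x | idx x = i}) :
    dualPartition (fun i => {x | idx x = i}) = Set.range fun i => {x | idx' x = i} := by
  have hiff := charSum_fiber_eq_iff idx idx' hidx hidx' h
  ext B
  constructor
  · rintro ⟨α, rfl⟩
    refine ⟨idx' α, ?_⟩
    ext β
    exact (hiff β α).symm
  · rintro ⟨i, rfl⟩
    obtain ⟨α, rfl⟩ := hidx' i
    refine ⟨α, ?_⟩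
    ext β
    exact (hiff β α).symm

end Partition

/-! ### Orthogonal complements and character sums over subspaces -/

section Orthogonal

variable {p n : ℕ} [Fact p.Prime]

/-- The orthogonal complement of a subspace for the ordinary inner product, as a subspace. -/
def orthSubmodule (W : Submodule (ZMod p) (Fin n → ZMod p)) :
    Submodule (ZMod p) (Fin n → ZMod p) :=
  LinearMap.BilinForm.orthogonal (dotProductBilin (ZMod p) (ZMod p)) W

theorem mem_orthSubmodule {W : Submodule (ZMod p) (Fin n → ZMod p)} {x : Fin n → ZMod p} :
    x ∈ orthSubmodule W ↔ ∀ y ∈ W, x ⬝ᵥ y = 0 := by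
  simp only [orthSubmodule, LinearMap.BilinForm.mem_orthogonal_iff]
  exact forall₂_congr fun y _ => by rw [dotProduct_comm]; rfl

theorem orthSet_coe (W : Submodule (ZMod p) (Fin n → ZMod p)) :
    orthSet (W : Set (Fin n → ZMod p)) = orthSubmodule W :=
  Set.ext fun _ => mem_orthSubmodule.symm

theorem dotProductBilin_isRefl :
    LinearMap.BilinForm.IsRefl (dotProductBilin (ZMod p) (ZMod p) (m := Fin n)) :=
  fun x y h => (dotProduct_comm y x).trans h

theorem dotProductBilin_nondegenerate :
    LinearMap.BilinForm.Nondegenerate (dotProductBilin (ZMod p) (ZMod p) (m := Fin n)) := by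
  refine ⟨fun x hx => ?_, fun x hx => ?_⟩
  · exact dotProduct_eq_zero x hx
  · exact dotProduct_eq_zero x fun y => (dotProduct_comm x y).trans (hx y)

theorem orthSubmodule_orthSubmodule (W : Submodule (ZMod p) (Fin n → ZMod p)) :
    orthSubmodule (orthSubmodule W) = W :=
  LinearMap.BilinForm.orthogonal_orthogonal dotProductBilin_nondegenerate dotProductBilin_isRefl W

theorem card_submodule (W : Submodule (ZMod p) (Fin n → ZMod p)) :
    Nat.card W = p ^ Module.finrank (ZMod p) W := by
  rw [Module.natCard_eq_pow_finrank (K := ZMod p), Nat.card_zmod]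

theorem card_orthSubmodule (W : Submodule (ZMod p) (Fin n → ZMod p)) :
    Nat.card (orthSubmodule W) = p ^ (n - Module.finrank (ZMod p) W) := by
  rw [card_submodule, orthSubmodule,
    LinearMap.BilinForm.finrank_orthogonal dotProductBilin_nondegenerate, Module.finrank_fin_fun]

open Classical in
/-- The sum of `ξ ^ (f x + α · x)` over the points `x` of `A`. -/
noncomputable def partialSum (A : Set (Fin n → ZMod p)) (f : (Fin n → ZMod p) → ZMod p)
    (α : Fin n → ZMod p) : ℂ :=
  ∑ x : Fin n → ZMod p with x ∈ A, ZMod.stdAddChar (f x + α ⬝ᵥ x)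

theorem partialSum_zero_fun (A : Set (Fin n → ZMod p)) (α : Fin n → ZMod p) :
    partialSum A 0 α = charSum α A := by
  simp [partialSum, charSum]

theorem charSum_zero (A : Set (Fin n → ZMod p)) : charSum 0 A = A.ncard := by
  classical
  rw [Set.ncard_eq_toFinset_card']
  simp [charSum]

theorem charSum_singleton_zero (α : Fin n → ZMod p) : charSum α {0} = 1 := by
  classical
  simp [charSum, Finset.filter_eq']

theorem charSum_sdiff {A B : Set (Fin n → ZMod p)} (h : B ⊆ A) (α : Fin n → ZMod p) :
    charSum α (A \ B) = charSum α A - charSum α B := by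
  classical
  simp only [charSum, Finset.sum_filter, ← Finset.sum_sub_distrib]
  refine Finset.sum_congr rfl fun x _ => ?_
  by_cases hA : x ∈ A <;> by_cases hB : x ∈ B
  · simp [hA, hB]
  · simp [hA, hB]
  · exact absurd (h hB) hA
  · simp [hA, hB]

open Classical in
theorem charSum_submodule (W : Submodule (ZMod p) (Fin n → ZMod p)) (α : Fin n → ZMod p) :
    charSum α (W : Set (Fin n → ZMod p)) =
      if α ∈ orthSubmodule W then (Nat.card W : ℂ) else 0 := by
  let ψ : AddChar W ℂ :=
    { toFun := fun x => ZMod.stdAddChar (α ⬝ᵥ (x : Fin n → ZMod p))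
      map_zero_eq_one' := by simp
      map_add_eq_mul' := fun a b => by
        rw [Submodule.coe_add, dotProduct_add, AddChar.map_add_eq_mul] }
  have h1 : charSum α (W : Set (Fin n → ZMod p)) = ∑ x : W, ψ x := by
    rw [charSum, Finset.sum_subtype (p := fun x => x ∈ W) _ (by simp)]
    rfl
  have h2 : ψ = 0 ↔ α ∈ orthSubmodule W := by
    rw [mem_orthSubmodule, AddChar.eq_zero_iff]
    refine ⟨fun h y hy => ?_, fun h x => ?_⟩
    · have h3 : (ZMod.stdAddChar (α ⬝ᵥ y) : ℂ) = 1 := h ⟨y, hy⟩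
      rw [← AddChar.map_zero_eq_one (ZMod.stdAddChar (N := p))] at h3
      exact ZMod.injective_stdAddChar h3
    · change (ZMod.stdAddChar (α ⬝ᵥ (x : Fin n → ZMod p)) : ℂ) = 1
      rw [h x x.2, AddChar.map_zero_eq_one]
  rw [h1, AddChar.sum_eq_ite, Nat.card_eq_fintype_card]
  exact if_congr h2 rfl rfl

open Classical in
theorem charSum_orthSubmodule (W : Submodule (ZMod p) (Fin n → ZMod p)) (α : Fin n → ZMod p) :
    charSum α (orthSubmodule W : Set (Fin n → ZMod p)) =
      if α ∈ W then (Nat.card (orthSubmodule W) : ℂ) else 0 := by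
  rw [charSum_submodule, orthSubmodule_orthSubmodule]

open Classical in
theorem charSum_compl_submodule (W : Submodule (ZMod p) (Fin n → ZMod p)) (α : Fin n → ZMod p) :
    charSum α (W : Set (Fin n → ZMod p))ᶜ =
      (if α = 0 then (p : ℂ) ^ n else 0) -
        if α ∈ orthSubmodule W then (Nat.card W : ℂ) else 0 := by
  rw [Set.compl_eq_univ_sdiff, charSum_sdiff (Set.subset_univ _), charSum_submodule,
    ← sum_stdAddChar_dotProduct α]
  simp [charSum, dotProduct_comm]

/-- The indicator of a level set `f x = j`, expanded in additive characters of `𝔽_p`. -/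
theorem mul_charSum_level (A : Set (Fin n → ZMod p)) (f : (Fin n → ZMod p) → ZMod p) (j : ZMod p)
    (α : Fin n → ZMod p) :
    p * charSum α {x | x ∈ A ∧ f x = j} =
      ∑ a : ZMod p, ZMod.stdAddChar (-(a * j)) * partialSum A (fun x => a * f x) α := by
  classical
  simp only [partialSum, charSum, Set.mem_ofPred_eq, Finset.sum_filter, Finset.mul_sum]
  rw [Finset.sum_comm]
  refine Finset.sum_congr rfl fun x _ => ?_
  by_cases hA : x ∈ A
  · have h1 : ∀ a : ZMod p, (ZMod.stdAddChar (-(a * j)) : ℂ) *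
        ZMod.stdAddChar (a * f x + α ⬝ᵥ x) =
          ZMod.stdAddChar ((f x - j) * a) * ZMod.stdAddChar (α ⬝ᵥ x) := by
      intro a
      rw [← AddChar.map_add_eq_mul, ← AddChar.map_add_eq_mul]
      congr 1
      ring
    simp only [hA, true_and, if_true, h1, ← Finset.sum_mul]
    by_cases hj : f x = j
    · simp [hj, ZMod.card]
    · rw [sum_stdAddChar_mul _ (sub_ne_zero.2 hj), if_neg hj, mul_zero, zero_mul]
  · simp [hA]

/-- Galois conjugation by `ξ ↦ ξ ^ a` in an evaluation of a sum of roots of unity. -/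
theorem sum_stdAddChar_mul_eq {X : Type*} (s : Finset X) (g : X → ZMod p) (c : ℤ) (k : ZMod p)
    (h : ∑ x ∈ s, (ZMod.stdAddChar (g x) : ℂ) = c * ZMod.stdAddChar k) {a : ZMod p} (ha : a ≠ 0) :
    ∑ x ∈ s, (ZMod.stdAddChar (a * g x) : ℂ) = c * ZMod.stdAddChar (a * k) := by
  have h1 := sum_mul_stdAddChar_mul_eq_zero (Finset.insertNone s)
    (fun o => o.elim (-c) fun _ => 1) (fun o => o.elim k g)
    (by rw [Finset.sum_insertNone]; simp [h]) ha
  rw [Finset.sum_insertNone] at h1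
  simp only [Option.elim, Int.cast_neg, Int.cast_one, one_mul, neg_mul] at h1
  linear_combination h1

theorem partialSum_mul_fun (A : Set (Fin n → ZMod p)) (f : (Fin n → ZMod p) → ZMod p)
    (α : Fin n → ZMod p) {a : ZMod p} (ha : a ≠ 0) {c : ℤ} {k : ZMod p}
    (h : partialSum A f (a⁻¹ • α) = c * ZMod.stdAddChar k) :
    partialSum A (fun x => a * f x) α = c * ZMod.stdAddChar (a * k) := by
  rw [← sum_stdAddChar_mul_eq _ _ c k h ha, partialSum]
  refine Finset.sum_congr rfl fun x _ => ?_
  rw [mul_add, smul_dotProduct, smul_eq_mul, mul_inv_cancel_left₀ ha]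

end Orthogonal

/-! ### Walsh transforms of dual-bent functions -/

section Walsh

variable {p n m : ℕ} [Fact p.Prime]

omit [Fact p.Prime] in
theorem halfPow_eq (hn : n = 2 * m) : halfPow p n = (p : ℂ) ^ m := by
  have h1 : ((n : ℝ) / 2) = (m : ℝ) := by
    rw [hn]; push_cast; ring
  rw [halfPow, h1, Real.rpow_natCast]
  push_cast
  rfl

theorem mu_eq_one (hp : p ≠ 2) (hn : n = 2 * m) : mu p n = 1 := by
  have h1 : p ^ 2 % 4 = 1 := by
    have := ((Fact.out : p.Prime).odd_of_ne_two hp)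
    rcases Nat.odd_mod_four_iff.1 (Nat.odd_iff.1 this) with h | h <;> simp [Nat.pow_mod, h]
  rw [mu, if_pos]
  rw [hn, pow_mul, Nat.pow_mod, h1]
  simp

theorem stdAddChar_ne_neg (hp : p ≠ 2) (j k : ZMod p) :
    (ZMod.stdAddChar j : ℂ) ≠ -ZMod.stdAddChar k := by
  intro h
  have hodd := (Fact.out : p.Prime).odd_of_ne_two hp
  have hpow : ∀ i : ZMod p, (ZMod.stdAddChar i : ℂ) ^ p = 1 := fun i => by
    rw [← AddChar.map_nsmul_eq_pow]; simp
  have h1 := congrArg (· ^ p) h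
  simp only [hodd.neg_pow, hpow] at h1
  norm_num at h1

theorem walsh_eq_partialSum (f : (Fin n → ZMod p) → ZMod p) (α : Fin n → ZMod p) :
    walsh f α = partialSum Set.univ f (-α) := by
  simp [walsh, partialSum, sub_eq_add_neg]

open Classical in
/-- The sign of the Walsh coefficient of `f` at `α`: it is `1` on `B_+(f)` and `-1` elsewhere. -/
noncomputable def walshSign (f : (Fin n → ZMod p) → ZMod p) (α : Fin n → ZMod p) : ℤ :=
  if α ∈ bPlus f then 1 else -1

theorem walshSign_eq_or (f : (Fin n → ZMod p) → ZMod p) (α : Fin n → ZMod p) :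
    walshSign f α = 1 ∨ walshSign f α = -1 := by
  unfold walshSign
  split_ifs <;> simp

theorem walsh_eq_or {f : (Fin n → ZMod p) → ZMod p} (hp : p ≠ 2) (hn : n = 2 * m)
    (hf : IsBent f) (α : Fin n → ZMod p) :
    walsh f α = (p : ℂ) ^ m * ZMod.stdAddChar (bentDual f α) ∨
      walsh f α = -((p : ℂ) ^ m) * ZMod.stdAddChar (bentDual f α) := by
  have h1 := hf α
  have h2 : ((n : ℝ) / 2) = (m : ℝ) := by
    rw [hn]; push_cast; ring
  rw [h2, Real.rpow_natCast] at h1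
  have h3 : ∃ j : ZMod p, walsh f α = (p : ℂ) ^ m * ZMod.stdAddChar j ∨
      walsh f α = -((p : ℂ) ^ m) * ZMod.stdAddChar j :=
    exists_eq_pow_mul_stdAddChar hp (fun x => f x - α ⬝ᵥ x) m h1
  have h4 : walsh f α = mu p n * halfPow p n * ZMod.stdAddChar (bentDual f α) ∨
      walsh f α = -mu p n * halfPow p n * ZMod.stdAddChar (bentDual f α) :=
    Classical.epsilon_spec (p := fun j : ZMod p =>
    walsh f α = mu p n * halfPow p n * ZMod.stdAddChar j ∨
      walsh f α = -mu p n * halfPow p n * ZMod.stdAddChar j)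
    (by simpa only [mu_eq_one hp hn, halfPow_eq hn, one_mul, neg_mul] using h3)
  simpa only [mu_eq_one hp hn, halfPow_eq hn, one_mul, neg_mul] using h4

theorem mem_bPlus_iff (hp : p ≠ 2) (hn : n = 2 * m) {f : (Fin n → ZMod p) → ZMod p}
    {α : Fin n → ZMod p} :
    α ∈ bPlus f ↔ walsh f α = (p : ℂ) ^ m * ZMod.stdAddChar (bentDual f α) := by
  rw [bPlus, Set.mem_ofPred_eq, mu_eq_one hp hn, halfPow_eq hn, one_mul]

theorem walsh_eq_sign_mul {f : (Fin n → ZMod p) → ZMod p} (hp : p ≠ 2) (hn : n = 2 * m)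
    (hf : IsBent f) (α : Fin n → ZMod p) :
    walsh f α = walshSign f α * (p : ℂ) ^ m * ZMod.stdAddChar (bentDual f α) := by
  by_cases h : α ∈ bPlus f
  · rw [walshSign, if_pos h, (mem_bPlus_iff hp hn).1 h]
    simp
  · rw [walshSign, if_neg h]
    rcases walsh_eq_or hp hn hf α with h1 | h1
    · exact absurd ((mem_bPlus_iff hp hn).2 h1) h
    · rw [h1]; simp

theorem bMinus_eq_compl {f : (Fin n → ZMod p) → ZMod p} (hp : p ≠ 2) (hn : n = 2 * m)
    (hf : IsBent f) : bMinus f = (bPlus f)ᶜ := by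
  have hp0 : (p : ℂ) ^ m ≠ 0 := pow_ne_zero _ (by exact_mod_cast (Fact.out : p.Prime).ne_zero)
  ext α
  rw [bMinus, Set.mem_ofPred_eq, mu_eq_one hp hn, halfPow_eq hn, Set.mem_compl_iff,
    mem_bPlus_iff hp hn]
  constructor
  · intro h1 h2
    refine stdAddChar_ne_neg hp (bentDual f α) (bentDual f α) (mul_left_cancel₀ hp0 ?_)
    rw [← h2, h1]
    ring
  · intro h
    rw [(walsh_eq_or hp hn hf α).resolve_left h]
    ring

theorem bentDual_eq_of_walsh_eq {f : (Fin n → ZMod p) → ZMod p} (hp : p ≠ 2) (hn : n = 2 * m)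
    (hf : IsBent f) {α : Fin n → ZMod p} {c : ℤ} (hc : c = 1 ∨ c = -1) {k : ZMod p}
    (h : walsh f α = c * (p : ℂ) ^ m * ZMod.stdAddChar k) : bentDual f α = k := by
  have hp0 : (p : ℂ) ^ m ≠ 0 := pow_ne_zero _ (by exact_mod_cast (Fact.out : p.Prime).ne_zero)
  rw [walsh_eq_sign_mul hp hn hf] at h
  rcases walshSign_eq_or f α with h1 | h1 <;> rcases hc with rfl | rfl <;> rw [h1] at h
  · exact ZMod.injective_stdAddChar (mul_left_cancel₀ hp0 (by simpa using h))
  · exact absurd (mul_left_cancel₀ hp0 (by simpa using h)) (stdAddChar_ne_neg hp _ k)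
  · refine absurd (mul_left_cancel₀ hp0 ?_) (stdAddChar_ne_neg hp k (bentDual f α))
    simpa using h.symm
  · exact ZMod.injective_stdAddChar (mul_left_cancel₀ hp0 (by simpa using h))

theorem walsh_neg {f : (Fin n → ZMod p) → ZMod p} (heven : ∀ x, f (-x) = f x)
    (α : Fin n → ZMod p) : walsh f (-α) = walsh f α := by
  rw [walsh, ← Equiv.sum_comp (Equiv.neg _), walsh]
  refine Finset.sum_congr rfl fun x _ => ?_
  rw [Equiv.neg_apply, heven, neg_dotProduct_neg]

theorem bentDual_neg {f : (Fin n → ZMod p) → ZMod p} (heven : ∀ x, f (-x) = f x)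
    (α : Fin n → ZMod p) : bentDual f (-α) = bentDual f α := by
  simp only [bentDual, walsh_neg heven]

/-- Fourier inversion for the Walsh transform of a bent function. -/
theorem sum_walshSign_mul {f : (Fin n → ZMod p) → ZMod p} (hp : p ≠ 2) (hn : n = 2 * m)
    (hf : IsBent f) (x : Fin n → ZMod p) :
    ∑ α, (walshSign f α : ℂ) * ZMod.stdAddChar (bentDual f α + x ⬝ᵥ α) =
      (p : ℂ) ^ m * ZMod.stdAddChar (f x) := by
  have hp0 : (p : ℂ) ^ m ≠ 0 := pow_ne_zero _ (by exact_mod_cast (Fact.out : p.Prime).ne_zero)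
  have h1 := sum_fourier_mul_stdAddChar_neg (fun x => (ZMod.stdAddChar (f x) : ℂ)) x
  rw [← Equiv.sum_comp (Equiv.neg _)] at h1
  have h2 : ∀ α : Fin n → ZMod p,
      (∑ x, (ZMod.stdAddChar (f x) : ℂ) * ZMod.stdAddChar ((-α) ⬝ᵥ x)) = walsh f α := by
    intro α
    refine Finset.sum_congr rfl fun x _ => ?_
    rw [← AddChar.map_add_eq_mul, neg_dotProduct, sub_eq_add_neg]
  simp only [Equiv.neg_apply, h2, walsh_eq_sign_mul hp hn hf] at h1
  simp only [neg_dotProduct, neg_neg] at h1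
  refine mul_left_cancel₀ hp0 ?_
  rw [← mul_assoc, ← pow_add, ← two_mul, ← hn, ← h1, Finset.mul_sum]
  refine Finset.sum_congr rfl fun α _ => ?_
  rw [AddChar.map_add_eq_mul, dotProduct_comm x α]
  ring

open Classical in
theorem two_mul_partialSum_bPlus (f g : (Fin n → ZMod p) → ZMod p) (x : Fin n → ZMod p) :
    2 * partialSum (bPlus f) g x = partialSum Set.univ g x +
      ∑ α, (walshSign f α : ℂ) * ZMod.stdAddChar (g α + x ⬝ᵥ α) := by
  simp only [partialSum, Finset.sum_filter, Finset.mul_sum, Set.mem_univ, if_true,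
    ← Finset.sum_add_distrib]
  refine Finset.sum_congr rfl fun α _ => ?_
  by_cases h : α ∈ bPlus f
  · simp [walshSign, h, two_mul]
  · simp [walshSign, h]

theorem odd_natCast_pow (hp : p ≠ 2) (m : ℕ) : Odd ((p : ℤ) ^ m) := by
  exact_mod_cast ((Fact.out : p.Prime).odd_of_ne_two hp).pow

/-- The dual of the dual is `x ↦ f (-x)`. By Fourier inversion, twice a sum of roots of unity
equals `p ^ m (ξ ^ (f x) ± ξ ^ (f^{**} (-x)))`, and `p ^ m` is odd. -/
theorem bentDual_bentDual_neg {f : (Fin n → ZMod p) → ZMod p} (hp : p ≠ 2) (hn : n = 2 * m)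
    (hf : IsBent f) (hf' : IsBent (bentDual f)) (x : Fin n → ZMod p) :
    bentDual (bentDual f) (-x) = f x := by
  classical
  have h1 := two_mul_partialSum_bPlus f (bentDual f) x
  rw [sum_walshSign_mul hp hn hf] at h1
  have h2 := walsh_eq_partialSum (bentDual f) (-x)
  rw [neg_neg] at h2
  rw [← h2, walsh_eq_sign_mul hp hn hf'] at h1
  have h3 := sum_mul_comp_eq_sum_fiber (Finset.univ.filter (· ∈ bPlus f)) (fun _ => 1)
    (fun α => bentDual f α + x ⬝ᵥ α) (fun j => (ZMod.stdAddChar j : ℂ))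
  simp only [Int.cast_one, one_mul] at h3
  rw [partialSum, h3] at h1
  refine (eq_of_sum_even_mul_stdAddChar_eq hp _ (odd_natCast_pow hp m)
    (v := walshSign (bentDual f) (-x) * (p : ℤ) ^ m) _ _ (h1.trans ?_)).symm
  push_cast
  ring

theorem bentDual_bentDual {f : (Fin n → ZMod p) → ZMod p} (hp : p ≠ 2) (hn : n = 2 * m)
    (hf : IsBent f) (hf' : IsBent (bentDual f)) (heven : ∀ x, f (-x) = f x) :
    bentDual (bentDual f) = f := by
  funext x
  rw [← neg_neg x, bentDual_bentDual_neg hp hn hf hf', neg_neg, heven]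

theorem even_card_filter_ne_zero (hp : p ≠ 2) {f : (Fin n → ZMod p) → ZMod p}
    (heven : ∀ x, f (-x) = f x) (j : ZMod p) :
    Even (Finset.card {x : Fin n → ZMod p | x ≠ 0 ∧ f x = j}) := by
  rw [← ZMod.natCast_eq_zero_iff_even, Finset.card_eq_sum_ones, Nat.cast_sum]
  refine Finset.sum_involution (fun x _ => -x) ?_ ?_ ?_ ?_
  · intro x _
    decide
  · intro x hx _ hneg
    refine (Finset.mem_filter.1 hx).2.1 ?_
    have h2 : (2 : ZMod p) ≠ 0 := by
      intro h
      have h3 : ((2 : ℕ) : ZMod p) = 0 := by exact_mod_cast h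
      rw [ZMod.natCast_eq_zero_iff] at h3
      exact hp ((Nat.prime_dvd_prime_iff_eq Fact.out Nat.prime_two).1 h3)
    have h3 : (2 : ZMod p) • x = 0 := by
      rw [two_smul]
      nth_rewrite 1 [← hneg]
      exact neg_add_cancel x
    exact (smul_eq_zero.1 h3).resolve_left h2
  · intro x hx
    simpa [heven] using hx
  · intro x _
    exact neg_neg x

/-- For an even function with `f 0 = 0` the dual also vanishes at `0`: in
`∑ x, ξ ^ (f x) = 1 + ∑ x ≠ 0, ξ ^ (f x)` the last sum has even coefficients. -/
theorem bentDual_zero {f : (Fin n → ZMod p) → ZMod p} (hp : p ≠ 2) (hn : n = 2 * m)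
    (hf : IsBent f) (heven : ∀ x, f (-x) = f x) (hzero : f 0 = 0) : bentDual f 0 = 0 := by
  classical
  have h1 := walsh_eq_sign_mul hp hn hf 0
  choose N hN using fun j => even_iff_two_dvd.1 (even_card_filter_ne_zero hp heven j)
  have h2 : walsh f 0 = ZMod.stdAddChar (0 : ZMod p) + 2 * ∑ j, ((N j : ℤ) : ℂ) *
      ZMod.stdAddChar j := by
    have h3 := sum_mul_comp_eq_sum_fiber (Finset.univ.filter fun x : Fin n → ZMod p => x ≠ 0)
      (fun _ => 1) f (fun j => (ZMod.stdAddChar j : ℂ))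
    simp only [Int.cast_one, one_mul, Finset.filter_filter, Finset.sum_const, nsmul_eq_mul,
      mul_one, hN] at h3
    rw [walsh, ← Finset.add_sum_erase _ _ (Finset.mem_univ 0), ← Finset.filter_ne']
    simp only [zero_dotProduct, sub_zero, hzero, h3, Finset.mul_sum]
    congr 1
    refine Finset.sum_congr rfl fun j _ => ?_
    push_cast
    ring
  rw [h1] at h2
  refine (eq_of_sum_even_mul_stdAddChar_eq hp (fun j => (N j : ℤ))
    (u := -1) (v := walshSign f 0 * (p : ℤ) ^ m) (by decide) 0 _ ?_).symm
  push_cast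
  linear_combination -h2

/-- The dual of a homogeneous bent function is homogeneous: the Galois conjugation `ξ ↦ ξ ^ (b ^ h)`
turns the Walsh coefficient at `β` into the one at `b ^ (h - 1) β`, and every element of `𝔽_p^*` is
of the form `b ^ (h - 1)`. -/
theorem exists_bentDual_smul {f : (Fin n → ZMod p) → ZMod p} (hp : p ≠ 2) (hn : n = 2 * m)
    (hf : IsBent f) {h : ℕ} (hpos : 0 < h) (hcop : Nat.gcd (h - 1) (p - 1) = 1)
    (hhom : ∀ a : ZMod p, a ≠ 0 → ∀ x, f (a • x) = a ^ h * f x) :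
    ∃ l : ℕ, ∀ a : ZMod p, a ≠ 0 → ∀ β, bentDual f (a • β) = a ^ l * bentDual f β := by
  have hpp : p.Prime := Fact.out
  have hp3 : 1 < p - 1 := by
    have := hpp.two_le
    omega
  have hconj : ∀ b : ZMod p, b ≠ 0 → ∀ β,
      bentDual f (b ^ (h - 1) • β) = b ^ h * bentDual f β := by
    intro b hb β
    refine bentDual_eq_of_walsh_eq hp hn hf (walshSign_eq_or f β) ?_
    have h1 := sum_stdAddChar_mul_eq Finset.univ (fun x => f x - β ⬝ᵥ x)
      (walshSign f β * (p : ℤ) ^ m) (bentDual f β)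
      (by push_cast; exact walsh_eq_sign_mul hp hn hf β) (pow_ne_zero h hb)
    push_cast at h1
    rw [← h1, walsh, ← Equiv.sum_comp (LinearEquiv.smulOfNeZero (ZMod p) _ b hb).toEquiv]
    refine Finset.sum_congr rfl fun x _ => ?_
    have h2 : b ^ h = b ^ (h - 1) * b := by rw [← pow_succ, Nat.sub_add_cancel hpos]
    change (ZMod.stdAddChar (f (b • x) - (b ^ (h - 1) • β) ⬝ᵥ (b • x)) : ℂ) = _
    rw [hhom b hb, smul_dotProduct, dotProduct_smul, smul_eq_mul, smul_eq_mul, h2]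
    congr 1
    ring
  obtain ⟨k, -, hk⟩ := Nat.exists_mul_mod_eq_one_of_coprime hcop hp3
  refine ⟨k * h, fun a ha β => ?_⟩
  have h1 : (a ^ k) ^ (h - 1) = a := by
    rw [← pow_mul, mul_comm, ← Nat.div_add_mod ((h - 1) * k) (p - 1), hk, pow_add, pow_mul,
      ZMod.pow_card_sub_one_eq_one ha, one_pow, one_mul, pow_one]
  have h2 := hconj (a ^ k) (pow_ne_zero k ha) β
  rwa [h1, ← pow_mul] at h2

theorem even_of_homogeneous {f : (Fin n → ZMod p) → ZMod p} (hp : p ≠ 2) {h : ℕ}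
    (hcop : Nat.gcd (h - 1) (p - 1) = 1)
    (hhom : ∀ a : ZMod p, a ≠ 0 → ∀ x, f (a • x) = a ^ h * f x) (x : Fin n → ZMod p) :
    f (-x) = f x := by
  have heven : Even h := by
    by_contra hodd
    have h1 : 2 ∣ h - 1 := by
      obtain ⟨t, rfl⟩ := Nat.not_even_iff_odd.1 hodd
      simp
    have h2 : 2 ∣ p - 1 := by
      obtain ⟨t, ht⟩ := (Fact.out : p.Prime).odd_of_ne_two hp
      omega
    have h3 := Nat.dvd_gcd h1 h2
    omega
  have h1 := hhom (-1) (by simp) x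
  rwa [neg_one_smul, heven.neg_one_pow, one_mul] at h1

open Classical in
/-- Sums of `ξ ^ (f x + α · x)` over `B_+(f^*)`: the sum over the whole space is the Walsh transform
of `f`, and the signed sum is evaluated by Fourier inversion for `f^*`. -/
theorem partialSum_bPlus_bentDual {f : (Fin n → ZMod p) → ZMod p} (hp : p ≠ 2) (hn : n = 2 * m)
    (hf : IsBent f) (hf' : IsBent (bentDual f)) (heven : ∀ x, f (-x) = f x)
    (α : Fin n → ZMod p) :
    partialSum (bPlus (bentDual f)) f α =
      if α ∈ bPlus f then (p : ℂ) ^ m * ZMod.stdAddChar (bentDual f α) else 0 := by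
  have h1 := two_mul_partialSum_bPlus (bentDual f) f α
  have h2 := sum_walshSign_mul hp hn hf' α
  rw [bentDual_bentDual hp hn hf hf' heven] at h2
  have h3 := walsh_eq_partialSum f (-α)
  rw [neg_neg, walsh_neg heven, walsh_eq_sign_mul hp hn hf] at h3
  rw [h2, ← h3] at h1
  refine mul_left_cancel₀ two_ne_zero (h1.trans ?_)
  by_cases h : α ∈ bPlus f
  · simp [walshSign, h]; ring
  · simp [walshSign, h]

theorem partialSum_compl (A : Set (Fin n → ZMod p)) (f : (Fin n → ZMod p) → ZMod p)
    (α : Fin n → ZMod p) :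
    partialSum Aᶜ f α = partialSum Set.univ f α - partialSum A f α := by
  classical
  rw [eq_sub_iff_add_eq']
  simp only [partialSum, Set.mem_compl_iff, Set.mem_univ, Finset.filter_true]
  exact Finset.sum_filter_add_sum_filter_not _ _ _

open Classical in
theorem partialSum_bPlus_bentDual_compl {f : (Fin n → ZMod p) → ZMod p} (hp : p ≠ 2)
    (hn : n = 2 * m) (hf : IsBent f) (hf' : IsBent (bentDual f)) (heven : ∀ x, f (-x) = f x)
    (α : Fin n → ZMod p) :
    partialSum (bPlus (bentDual f))ᶜ f α =
      if α ∈ bPlus f then 0 else -(p : ℂ) ^ m * ZMod.stdAddChar (bentDual f α) := by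
  have h3 := walsh_eq_partialSum f (-α)
  rw [neg_neg, walsh_neg heven, walsh_eq_sign_mul hp hn hf] at h3
  rw [partialSum_compl, partialSum_bPlus_bentDual hp hn hf hf' heven, ← h3]
  by_cases h : α ∈ bPlus f
  · simp [walshSign, h]
  · simp [walshSign, h]

end Walsh

/-! ### Split dual pairs -/

section SplitDualPair

variable {p n m r : ℕ} [Fact p.Prime]

open Classical in
/-- Functions `f` and `g` with subspaces `U` and `V` such that the Fourier transform of `ξ ^ f`
restricted to `U` is `p ^ m ξ ^ g` restricted to `V`, and the Fourier transform of `ξ ^ f`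
restricted to the complement of `U` is `-p ^ m ξ ^ g` restricted to the complement of `V`. For a
bent function `f` with bent dual `g` this holds with `U = B_+(g)` and `V = B_+(f)`. -/
structure IsSplitDualPair (m : ℕ) (f g : (Fin n → ZMod p) → ZMod p)
    (U V : Submodule (ZMod p) (Fin n → ZMod p)) : Prop where
  sum_mem : ∀ α, partialSum U f α = if α ∈ V then (p : ℂ) ^ m * ZMod.stdAddChar (g α) else 0
  sum_compl : ∀ α, partialSum (U : Set (Fin n → ZMod p))ᶜ f α =
    if α ∈ V then 0 else -(p : ℂ) ^ m * ZMod.stdAddChar (g α)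
  zero_left : f 0 = 0
  zero_right : g 0 = 0

variable {f g : (Fin n → ZMod p) → ZMod p} {U V : Submodule (ZMod p) (Fin n → ZMod p)}

/-- The sum of `ξ ^ (f x + α · x)` over `U` does not change if a vector orthogonal to `U` is added
to `α`. -/
theorem IsSplitDualPair.mem_and_eq_zero (h : IsSplitDualPair m f g U V) {y : Fin n → ZMod p}
    (hy : y ∈ orthSubmodule U) : y ∈ V ∧ g y = 0 := by
  have hp0 : (p : ℂ) ^ m ≠ 0 := pow_ne_zero _ (by exact_mod_cast (Fact.out : p.Prime).ne_zero)
  have h1 : partialSum U f y = partialSum U f 0 := by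
    unfold partialSum
    refine Finset.sum_congr rfl fun x hx => ?_
    rw [mem_orthSubmodule.1 hy x (by simpa using hx), zero_dotProduct]
  rw [h.sum_mem, h.sum_mem, if_pos V.zero_mem, h.zero_right, AddChar.map_zero_eq_one, mul_one] at h1
  by_cases hV : y ∈ V
  · refine ⟨hV, ?_⟩
    rw [if_pos hV] at h1
    apply ZMod.injective_stdAddChar
    rw [AddChar.map_zero_eq_one]
    exact mul_left_cancel₀ hp0 (h1.trans (mul_one _).symm)
  · rw [if_neg hV] at h1
    exact absurd h1.symm hp0

open Classical in
theorem IsSplitDualPair.sum_mem_mul (h : IsSplitDualPair m f g U V) {a : ZMod p} (ha : a ≠ 0)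
    (α : Fin n → ZMod p) :
    partialSum U (fun x => a * f x) α =
      if α ∈ V then (p : ℂ) ^ m * ZMod.stdAddChar (a * g (a⁻¹ • α)) else 0 := by
  have h1 := h.sum_mem (a⁻¹ • α)
  rw [Submodule.smul_mem_iff V (inv_ne_zero ha)] at h1
  split_ifs with hα
  · rw [if_pos hα] at h1
    rw [partialSum_mul_fun _ _ _ ha (c := (p : ℤ) ^ m) (k := g (a⁻¹ • α)) (by push_cast; exact h1)]
    push_cast
    rfl
  · rw [if_neg hα] at h1
    rw [partialSum_mul_fun _ _ _ ha (c := 0) (k := 0) (by rw [h1]; simp)]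
    simp

open Classical in
theorem IsSplitDualPair.sum_compl_mul (h : IsSplitDualPair m f g U V) {a : ZMod p} (ha : a ≠ 0)
    (α : Fin n → ZMod p) :
    partialSum (U : Set (Fin n → ZMod p))ᶜ (fun x => a * f x) α =
      if α ∈ V then 0 else -(p : ℂ) ^ m * ZMod.stdAddChar (a * g (a⁻¹ • α)) := by
  have h1 := h.sum_compl (a⁻¹ • α)
  rw [Submodule.smul_mem_iff V (inv_ne_zero ha)] at h1
  split_ifs with hα
  · rw [if_pos hα] at h1
    rw [partialSum_mul_fun _ _ _ ha (c := 0) (k := 0) (by rw [h1]; simp)]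
    simp
  · rw [if_neg hα] at h1
    rw [partialSum_mul_fun _ _ _ ha (c := -(p : ℤ) ^ m) (k := g (a⁻¹ • α))
      (by push_cast; exact h1)]
    push_cast
    rfl

theorem mul_charSum_level_eq_add (A : Set (Fin n → ZMod p)) (f : (Fin n → ZMod p) → ZMod p)
    (j : ZMod p) (α : Fin n → ZMod p) :
    p * charSum α {x | x ∈ A ∧ f x = j} =
      charSum α A + ∑ a ∈ (Finset.univ : Finset (ZMod p)).erase 0,
        ZMod.stdAddChar (-(a * j)) * partialSum A (fun x => a * f x) α := by
  rw [mul_charSum_level, ← Finset.add_sum_erase _ _ (Finset.mem_univ 0), ← partialSum_zero_fun]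
  congr 1
  rw [zero_mul, neg_zero, AddChar.map_zero_eq_one, one_mul]
  congr 1
  funext x
  simp

/-- The sizes of the level sets of `f` on `U`: the number of `x ∈ U` with `f x = j` is
`(|U| - p ^ m) / p`, increased by `p ^ m` for `j = 0`. -/
theorem IsSplitDualPair.mul_ncard_level (h : IsSplitDualPair m f g U V) (j : ZMod p) :
    (p : ℤ) * {x | x ∈ (U : Set (Fin n → ZMod p)) ∧ f x = j}.ncard =
      Nat.card U + (if j = 0 then (p : ℤ) ^ (m + 1) else 0) - (p : ℤ) ^ m := by
  have h1 := mul_charSum_level_eq_add (U : Set (Fin n → ZMod p)) f j 0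
  have h2 : ∑ a ∈ (Finset.univ : Finset (ZMod p)).erase 0, (ZMod.stdAddChar (-(a * j)) : ℂ) *
      partialSum U (fun x => a * f x) 0 =
        (∑ a : ZMod p, (ZMod.stdAddChar (-j * a) : ℂ) - 1) * (p : ℂ) ^ m := by
    rw [← Finset.add_sum_erase _ _ (Finset.mem_univ 0), mul_zero, AddChar.map_zero_eq_one,
      add_sub_cancel_left, Finset.sum_mul]
    refine Finset.sum_congr rfl fun a ha => ?_
    rw [h.sum_mem_mul (Finset.ne_of_mem_erase ha), if_pos V.zero_mem, smul_zero, h.zero_right,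
      mul_zero, AddChar.map_zero_eq_one, mul_one, neg_mul, mul_comm a j]
  rw [h2, charSum_zero, charSum_zero, ← Nat.card_coe_set_eq (U : Set (Fin n → ZMod p))] at h1
  have h3 : ((p : ℤ) * {x | x ∈ (U : Set (Fin n → ZMod p)) ∧ f x = j}.ncard : ℂ) =
      (Nat.card U + (if j = 0 then (p : ℤ) ^ (m + 1) else 0) - (p : ℤ) ^ m : ℤ) := by
    refine Eq.trans (by push_cast; rfl) (h1.trans ?_)
    by_cases hj : j = 0
    · simp [hj, ZMod.card]; ring
    · rw [sum_stdAddChar_mul _ (neg_ne_zero.2 hj), if_neg hj]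
      push_cast
      simp
      ring
  exact_mod_cast h3

theorem IsSplitDualPair.mul_ncard_level_compl (h : IsSplitDualPair m f g U V) (j : ZMod p) :
    (p : ℤ) * {x | x ∈ (U : Set (Fin n → ZMod p))ᶜ ∧ f x = j}.ncard = (p : ℤ) ^ n - Nat.card U := by
  have h1 := mul_charSum_level_eq_add (U : Set (Fin n → ZMod p))ᶜ f j 0
  rw [Finset.sum_eq_zero, charSum_compl_submodule, if_pos rfl, if_pos (Submodule.zero_mem _),
    charSum_zero, add_zero] at h1
  · exact_mod_cast h1
  · intro a ha
    rw [h.sum_compl_mul (Finset.ne_of_mem_erase ha), if_pos V.zero_mem, mul_zero]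

open Classical in
/-- The position in `schemeFamily` of the block that contains `x`, for the family built from a
set `Q` and the level sets of `f` on `U` and on its complement. -/
noncomputable def blockIndex (Q U : Set (Fin n → ZMod p)) (f : (Fin n → ZMod p) → ZMod p)
    (x : Fin n → ZMod p) : Fin (2 * p + 1 + 1) :=
  if x = 0 then 0
  else if x ∈ Q then 1
  else if x ∈ U then ⟨2 + (f x).val, by have := (f x).val_lt; omega⟩
  else ⟨p + 2 + (f x).val, by have := (f x).val_lt; omega⟩

open Classical in
theorem val_blockIndex (Q W : Set (Fin n → ZMod p)) (φ : (Fin n → ZMod p) → ZMod p)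
    (x : Fin n → ZMod p) :
    (blockIndex Q W φ x : ℕ) = if x = 0 then 0 else if x ∈ Q then 1
      else if x ∈ W then 2 + (φ x).val else p + 2 + (φ x).val := by
  unfold blockIndex
  split_ifs <;> simp

theorem blockIndex_eq_iff {Q W : Set (Fin n → ZMod p)} {φ : (Fin n → ZMod p) → ZMod p}
    (h0 : 0 ∈ Q) (hQ : ∀ x ∈ Q, x ∈ W ∧ φ x = 0) {x y : Fin n → ZMod p} :
    blockIndex Q W φ x = blockIndex Q W φ y ↔
      (x = 0 ↔ y = 0) ∧ (x ∈ Q ↔ y ∈ Q) ∧ (x ∈ W ↔ y ∈ W) ∧ φ x = φ y := by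
  classical
  rw [Fin.ext_iff, val_blockIndex, val_blockIndex, ← (ZMod.val_injective p).eq_iff]
  have hx := (φ x).val_lt
  have hy := (φ y).val_lt
  have hval : ∀ z ∈ Q, (φ z).val = 0 := fun z hz => by rw [(hQ z hz).2, ZMod.val_zero]
  have hW : ∀ z ∈ Q, z ∈ W := fun z hz => (hQ z hz).1
  have hQ0 : ∀ z, z = 0 → z ∈ Q := fun z hz => hz ▸ h0
  grind

theorem schemeFamily_eq_fiber {Q W : Set (Fin n → ZMod p)} {φ : (Fin n → ZMod p) → ZMod p}
    (h0 : 0 ∈ Q) (hQ : ∀ x ∈ Q, x ∈ W ∧ φ x = 0) :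
    schemeFamily Q (fun j => {x | x ∈ W ∧ φ x = j}) (fun j => {x | x ∈ Wᶜ ∧ φ x = j}) =
      fun i => {x | blockIndex Q W φ x = i} := by
  classical
  funext i
  ext x
  have hx := (φ x).val_lt
  have hi := i.2
  have hval : x ∈ Q → (φ x).val = 0 := fun hz => by rw [(hQ x hz).2, ZMod.val_zero]
  have hW : x ∈ Q → x ∈ W := fun hz => (hQ x hz).1
  have hQ0 : x = 0 → x ∈ Q := fun hz => hz ▸ h0
  have hcast : ∀ k < p, (φ x = (k : ZMod p) ↔ (φ x).val = k) := fun k hk => by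
    rw [← (ZMod.val_injective p).eq_iff, ZMod.val_natCast_of_lt hk]
  have hcast0 : φ x = 0 ↔ (φ x).val = 0 := (ZMod.val_eq_zero _).symm
  unfold schemeFamily
  change _ ↔ blockIndex Q W φ x = i
  split_ifs with h1 h2 h3 h4 <;> rw [Fin.ext_iff, val_blockIndex]
  · simp only [Set.mem_singleton_iff]
    grind
  · simp only [Set.mem_sdiff, Set.mem_singleton_iff]
    grind
  · simp only [Set.mem_sdiff, Set.mem_ofPred_eq, hcast0]
    grind
  · simp only [Set.mem_ofPred_eq, hcast ((i : ℕ) - 2) (by omega)]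
    grind
  · simp only [Set.mem_ofPred_eq, Set.mem_compl_iff, hcast ((i : ℕ) - (p + 2)) (by omega)]
    grind

/-- All blocks of the family built from `f` are nonempty, by the sizes of the level sets and
`|V^⊥| = p ^ (n - r)`. -/
theorem IsSplitDualPair.blockIndex_surjective (h : IsSplitDualPair m f g U V)
    (hQ : ∀ x ∈ orthSubmodule V, x ∈ U ∧ f x = 0) (hn : n = 2 * m) (hmr : m + 1 ≤ r)
    (hrn : r < n) (hU : Module.finrank (ZMod p) U = r) (hV : Module.finrank (ZMod p) V = r) :
    Function.Surjective (blockIndex (orthSubmodule V : Set (Fin n → ZMod p)) U f) := by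
  have hp2 : 2 ≤ p := (Fact.out : p.Prime).two_le
  have hp0 : (0 : ℤ) < p := by omega
  have hp1 : (1 : ℤ) < p := by omega
  have hcardU := card_submodule U
  have hcardV := card_orthSubmodule V
  rw [hU] at hcardU
  rw [hV] at hcardV
  have hmr' : (p : ℤ) ^ m < (p : ℤ) ^ r := pow_lt_pow_right₀ hp1 hmr
  have hrn' : (p : ℤ) ^ r < (p : ℤ) ^ n := pow_lt_pow_right₀ hp1 hrn
  have hlevel : ∀ j : ZMod p, {x | x ∈ (U : Set (Fin n → ZMod p)) ∧ f x = j}.Nonempty := by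
    intro j
    have h1 := h.mul_ncard_level j
    rw [hcardU] at h1
    rw [← Set.ncard_pos, ← Int.natCast_pos]
    refine pos_of_mul_pos_right (a := (p : ℤ)) ?_ hp0.le
    rw [h1]
    push_cast
    have : (0 : ℤ) < (p : ℤ) ^ (m + 1) := by positivity
    split_ifs <;> linarith
  have hlevel' : ∀ j : ZMod p, {x | x ∈ (U : Set (Fin n → ZMod p))ᶜ ∧ f x = j}.Nonempty := by
    intro j
    have h1 := h.mul_ncard_level_compl j
    rw [hcardU] at h1
    rw [← Set.ncard_pos, ← Int.natCast_pos]
    refine pos_of_mul_pos_right (a := (p : ℤ)) ?_ hp0.le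
    rw [h1]
    push_cast
    linarith
  have hzero : ({x | x ∈ (U : Set (Fin n → ZMod p)) ∧ f x = 0} \
      (orthSubmodule V : Set (Fin n → ZMod p))).Nonempty := by
    rw [Set.sdiff_nonempty]
    intro hsub
    have h1 := Set.ncard_le_ncard hsub
    have h2 := h.mul_ncard_level 0
    rw [← Nat.card_coe_set_eq (orthSubmodule V : Set (Fin n → ZMod p))] at h1
    have h3 : {x | x ∈ (U : Set (Fin n → ZMod p)) ∧ f x = 0}.ncard ≤ p ^ (n - r) := by
      rw [← hcardV]
      exact h1
    rw [hcardU, if_pos rfl] at h2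
    have h4 : (p : ℤ) * p ^ (n - r) ≤ (p : ℤ) ^ m := by
      rw [← pow_succ']
      exact pow_le_pow_right₀ hp1.le (by omega)
    have h5 : (p : ℤ) ^ m < (p : ℤ) ^ (m + 1) := pow_lt_pow_right₀ hp1 (Nat.lt_succ_self m)
    have h6 : (p : ℤ) * {x | x ∈ (U : Set (Fin n → ZMod p)) ∧ f x = 0}.ncard ≤
        (p : ℤ) * p ^ (n - r) := by
      refine mul_le_mul_of_nonneg_left ?_ hp0.le
      exact_mod_cast h3
    push_cast at h2
    linarith
  have horth : ((orthSubmodule V : Set (Fin n → ZMod p)) \ {0}).Nonempty := by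
    rw [Set.sdiff_nonempty]
    intro hsub
    have h1 := Set.ncard_le_ncard hsub
    rw [Set.ncard_singleton, ← Nat.card_coe_set_eq] at h1
    have h2 : p ^ (n - r) ≤ 1 := by
      rw [← hcardV]
      exact h1
    have h3 : 1 < p ^ (n - r) := Nat.one_lt_pow (by omega) (by omega)
    omega
  intro i
  change {x | blockIndex (orthSubmodule V : Set (Fin n → ZMod p)) U f x = i}.Nonempty
  rw [← congrFun (schemeFamily_eq_fiber (Submodule.zero_mem _) hQ) i]
  unfold schemeFamily
  split_ifs
  · exact Set.singleton_nonempty 0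
  · exact horth
  · exact hzero
  · exact hlevel _
  · exact hlevel' _

/-- The character sums over the blocks built from `f` depend only on the block built from `g`. Here
the homogeneity of `g` enters: `g α` determines `g (a α)`. -/
theorem IsSplitDualPair.charSum_blockIndex_eq (h : IsSplitDualPair m f g U V)
    (hQ : ∀ x ∈ orthSubmodule V, x ∈ U ∧ f x = 0)
    (hQ' : ∀ x ∈ orthSubmodule U, x ∈ V ∧ g x = 0)
    (hg : ∃ l : ℕ, ∀ a : ZMod p, a ≠ 0 → ∀ β, g (a • β) = a ^ l * g β) (α α' : Fin n → ZMod p)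
    (hα : blockIndex (orthSubmodule U : Set (Fin n → ZMod p)) V g α =
      blockIndex (orthSubmodule U : Set (Fin n → ZMod p)) V g α') (i : Fin (2 * p + 1 + 1)) :
    charSum α {x | blockIndex (orthSubmodule V : Set (Fin n → ZMod p)) U f x = i} =
      charSum α' {x | blockIndex (orthSubmodule V : Set (Fin n → ZMod p)) U f x = i} := by
  classical
  have hp0 : (p : ℂ) ≠ 0 := by exact_mod_cast (Fact.out : p.Prime).ne_zero
  obtain ⟨l, hl⟩ := hg
  obtain ⟨hz, ho, hv, hgα⟩ := (blockIndex_eq_iff (Submodule.zero_mem _) hQ').1 hα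
  simp only [SetLike.mem_coe] at ho hv
  have hlevel : ∀ j : ZMod p, charSum α {x | x ∈ (U : Set (Fin n → ZMod p)) ∧ f x = j} =
      charSum α' {x | x ∈ (U : Set (Fin n → ZMod p)) ∧ f x = j} := by
    intro j
    refine mul_left_cancel₀ hp0 ?_
    rw [mul_charSum_level_eq_add, mul_charSum_level_eq_add, charSum_submodule, charSum_submodule]
    congr 1
    · simp only [ho]
    · refine Finset.sum_congr rfl fun a ha => ?_
      have ha0 := Finset.ne_of_mem_erase ha
      rw [h.sum_mem_mul ha0, h.sum_mem_mul ha0, hl _ (inv_ne_zero ha0), hl _ (inv_ne_zero ha0), hgα]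
      simp only [hv]
  have hlevel' : ∀ j : ZMod p, charSum α {x | x ∈ (U : Set (Fin n → ZMod p))ᶜ ∧ f x = j} =
      charSum α' {x | x ∈ (U : Set (Fin n → ZMod p))ᶜ ∧ f x = j} := by
    intro j
    refine mul_left_cancel₀ hp0 ?_
    rw [mul_charSum_level_eq_add, mul_charSum_level_eq_add, charSum_compl_submodule,
      charSum_compl_submodule]
    congr 1
    · simp only [ho, hz]
    · refine Finset.sum_congr rfl fun a ha => ?_
      have ha0 := Finset.ne_of_mem_erase ha
      rw [h.sum_compl_mul ha0, h.sum_compl_mul ha0, hl _ (inv_ne_zero ha0),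
        hl _ (inv_ne_zero ha0), hgα]
      simp only [hv]
  have horth : charSum α (orthSubmodule V : Set (Fin n → ZMod p)) =
      charSum α' (orthSubmodule V : Set (Fin n → ZMod p)) := by
    rw [charSum_orthSubmodule, charSum_orthSubmodule]
    simp only [hv]
  rw [← congrFun (schemeFamily_eq_fiber (Submodule.zero_mem _) hQ) i]
  unfold schemeFamily
  split_ifs
  · rw [charSum_singleton_zero, charSum_singleton_zero]
  · have hsub : ({0} : Set (Fin n → ZMod p)) ⊆ orthSubmodule V :=
      Set.singleton_subset_iff.2 (Submodule.zero_mem _)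
    rw [charSum_sdiff hsub, charSum_sdiff hsub, horth, charSum_singleton_zero,
      charSum_singleton_zero]
  · have hsub : (orthSubmodule V : Set (Fin n → ZMod p)) ⊆
        {x | x ∈ (U : Set (Fin n → ZMod p)) ∧ f x = 0} := hQ
    rw [charSum_sdiff hsub, charSum_sdiff hsub, horth, hlevel]
  · exact hlevel _
  · exact hlevel' _

end SplitDualPair

theorem theorem1 (p : ℕ) [Fact p.Prime] (hp : p ≠ 2) (n : ℕ) (hn : 4 ≤ n) (hn_even : Even n)
    (r : ℕ) (hr : n / 2 + 1 ≤ r) (hr' : r ≤ n - 1)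
    (f : (Fin n → ZMod p) → ZMod p)
    (hf : IsNonWeaklyRegularBent f) (hf_dbf : IsDBF f)
    (hB : IsNondegenerateSubspace (bPlus f) r)
    (hB_star : IsNondegenerateSubspace (bPlus (bentDual f)) r) :
    IsPartitionFamily (bentFamily f) ∧
      IsSymmetricAssociationScheme (2 * p + 1) (differenceRelations (bentFamily f)) ∧
      IsPartitionFamily (bentStarFamily f) ∧
      dualPartition (bentFamily f) = Set.range (bentStarFamily f) := by
  classical
  obtain ⟨⟨hbent, hbent'⟩, hzero, h, hpos, hcop, hhom⟩ := hf_dbf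
  obtain ⟨V, hV, hVr, -⟩ := hB
  obtain ⟨U, hU, hUr, -⟩ := hB_star
  obtain ⟨m, hm⟩ := hn_even
  have hm2 : n = 2 * m := by omega
  have heven := even_of_homogeneous hp hcop hhom
  have hdd := bentDual_bentDual hp hm2 hbent hbent' heven
  have hzero' := bentDual_zero hp hm2 hbent heven hzero
  have heven' := bentDual_neg heven
  have hmemV : ∀ α, α ∈ bPlus f ↔ α ∈ V := fun α => by rw [← hV, SetLike.mem_coe]
  have hmemU : ∀ α, α ∈ bPlus (bentDual f) ↔ α ∈ U := fun α => by rw [← hU, SetLike.mem_coe]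
  have hpair : IsSplitDualPair m f (bentDual f) U V :=
    { sum_mem := fun α => by
        rw [hU, partialSum_bPlus_bentDual hp hm2 hbent hbent' heven]
        simp only [hmemV]
      sum_compl := fun α => by
        rw [hU, partialSum_bPlus_bentDual_compl hp hm2 hbent hbent' heven]
        simp only [hmemV]
      zero_left := hzero
      zero_right := hzero' }
  have hbent'' : IsBent (bentDual (bentDual f)) := by rwa [hdd]
  have hpair' : IsSplitDualPair m (bentDual f) f V U :=
    { sum_mem := fun α => by
        have h1 := partialSum_bPlus_bentDual hp hm2 hbent' hbent'' heven' α
        rw [hdd, ← hV] at h1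
        simpa only [hmemU] using h1
      sum_compl := fun α => by
        have h1 := partialSum_bPlus_bentDual_compl hp hm2 hbent' hbent'' heven' α
        rw [hdd, ← hV] at h1
        simpa only [hmemU] using h1
      zero_left := hzero'
      zero_right := hzero }
  have hQ : ∀ x ∈ orthSubmodule V, x ∈ U ∧ f x = 0 := fun _ => hpair'.mem_and_eq_zero
  have hQ' : ∀ x ∈ orthSubmodule U, x ∈ V ∧ bentDual f x = 0 := fun _ => hpair.mem_and_eq_zero
  have hfam : bentFamily f =
      fun i => {x | blockIndex (orthSubmodule V : Set (Fin n → ZMod p)) U f x = i} := by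
    rw [← schemeFamily_eq_fiber (Submodule.zero_mem _) hQ, bentFamily, ← hV, orthSet_coe]
    congr 1
    · simp only [hU]
      rfl
    · simp only [hU, ← bMinus_eq_compl hp hm2 hbent']
      rfl
  have hfam' : bentStarFamily f =
      fun i => {x | blockIndex (orthSubmodule U : Set (Fin n → ZMod p)) V (bentDual f) x = i} := by
    rw [← schemeFamily_eq_fiber (Submodule.zero_mem _) hQ', bentStarFamily, ← hU, orthSet_coe]
    congr 1
    · simp only [hV]
      rfl
    · simp only [hV, ← bMinus_eq_compl hp hm2 hbent]
      rfl
  have hsurj := hpair.blockIndex_surjective hQ hm2 (by omega) (by omega) hUr hVr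
  have hsurj' := hpair'.blockIndex_surjective hQ' hm2 (by omega) (by omega) hVr hUr
  have hconst := hpair.charSum_blockIndex_eq hQ hQ'
    (exists_bentDual_smul hp hm2 hbent hpos hcop hhom)
  rw [hfam, hfam']
  refine ⟨isPartitionFamily_fibers hsurj, ?_, isPartitionFamily_fibers hsurj',
    dualPartition_fibers _ _ hsurj hsurj' hconst⟩
  refine isSymmetricAssociationScheme_fibers _ _ hsurj hsurj' hconst (fun x => ?_) fun x => ?_
  · rw [← Fin.val_eq_val]
    rw [val_blockIndex]
    split_ifs <;> simp_all
  · refine (blockIndex_eq_iff (Submodule.zero_mem _) hQ).2 ⟨neg_eq_zero, ?_, ?_, heven x⟩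
    · exact neg_mem_iff
    · exact neg_mem_iff
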